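/- A metric graph $\Gamma$ is a finite collection of compact intervals (edges) of positive lengths whose end points are joined together at vertices (the classes of a partition of the set of end points); loops, multiple edges and disconnected graphs are allowed. The spectrum of $\Gamma$ is the multiset of eigenvalues (counted with multiplicity) of the standard Laplacian $L=-\frac{d^2}{dx^2}$ in $L_2(\Gamma)$, whose domain consists of the functions that are in $W_2^2$ on every edge, are continuous at every vertex, and have, at every vertex $V$, vanishing sum $\partial u(V)$ of the derivatives at the end points joined at $V$, taken in the direction into the edges. Two metric graphs are isospectral if their spectra coincide as multisets. If distinct contact vertices $V_i$, $i\in B$, of $\Gamma$ are selected, the $M$-function $\mathbb M_\Gamma(\lambda)$, $\operatorname{Im}\lambda\neq0$, is the linear map $\mathbb C^B\to\mathbb C^B$, $\{u(V_i)\}_{i\in B}\mapsto\{\partial u(V_i)\}_{i\in B}$, where $u$ runs through the solutions of $-u''=\lambda u$ on the edges which are continuous at all vertices and satisfy $\partial u(V)=0$ at all non-contact vertices $V$. Two metric graphs with contact vertices labelled by the same set $B$ are Steklov-equivalent if their $M$-functions are equal for all nonreal $\lambda$. **Method 1 (Extending of isospectral pairs).** Let $\mathbf R_1$ and $\mathbf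 R_2$ be metric graphs with contact vertices labelled by the same set $B$. Assume that they are Steklov-equivalent and isospectral. Let $\mathbf K$ be an arbitrary metric graph and let $P$ be any set of pairs $(i,m)$ of a label $i\in B$ and a vertex $m$ of $\mathbf K$. For $j=1,2$, let $\mathbf \Gamma_j$ be the metric graph obtained by gluing $\mathbf R_j$ to $\mathbf K$, identifying, for every $(i,m)\in P$, the contact vertex of $\mathbf R_j$ with label $i$ and the vertex $m$ of $\mathbf K$. Then $\mathbf\Gamma_1$ and $\mathbf\Gamma_2$ are isospectral. -/

import Mathlib

open MeasureTheory Set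

universe u v

/-- A (finite, compact) metric graph: finitely many edges, the edge `e` being a copy of the interval
`[0, len e]` with `len e > 0`, whose end points are joined together at the vertices.
The end point `(e, false)` is the left end point `0` and `(e, true)` the right end point `len e` of
the edge `e`; the vertices are the classes of end points with the same value of `vtx`, all of them
nonempty. Loops, multiple edges and several connected components are allowed. -/
structure MetricGraph where
  E : Type u
  V : Type u
  [finE : Fintype E]
  len : E → ℝ
  len_pos : ∀ e, 0 < len e
  vtx : E × Bool → V
  vtx_surj : Function.Surjective vtx

namespace MetricGraph

attribute [instance] MetricGraph.finE

/-- The restriction of Lebesgue measure to the edge `e`. -/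
noncomputable abbrev edgeMeasure (G : MetricGraph.{u}) (e : G.E) : Measure ℝ :=
  volume.restrict (Icc 0 (G.len e))

/-- The Hilbert space `L₂(Γ)`, the orthogonal sum of the spaces `L₂` of the edges. -/
abbrev L2 (G : MetricGraph.{u}) : Type u :=
  PiLp 2 fun e : G.E => Lp ℂ 2 (G.edgeMeasure e)

/-- A function in the orthogonal sum of the Sobolev spaces `W₂²` of the edges: on every edge,
`u` is a primitive of `du`, which is a primitive of the square integrable function `ddu`.
So `u` and `du` are the continuous representatives of the function and of its derivative, and `ddu`
is its second derivative. Only the values on the edges are relevant. -/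
structure W22 (G : MetricGraph.{u}) where
  u : G.E → ℝ → ℂ
  du : G.E → ℝ → ℂ
  ddu : G.E → ℝ → ℂ
  memLp : ∀ e, MemLp (ddu e) 2 (G.edgeMeasure e)
  du_eq : ∀ e, ∀ x ∈ Icc 0 (G.len e), du e x = du e 0 + ∫ t in (0 : ℝ)..x, ddu e t
  u_eq : ∀ e, ∀ x ∈ Icc 0 (G.len e), u e x = u e 0 + ∫ t in (0 : ℝ)..x, du e t

namespace W22

variable {G : MetricGraph.{u}}

/-- The value of `w` at an end point of an edge. -/
def trace (w : W22 G) (p : G.E × Bool) : ℂ :=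
  w.u p.1 (if p.2 then G.len p.1 else 0)

/-- The oriented derivative of `w` at an end point, directed into the edge. -/
def normalDeriv (w : W22 G) (p : G.E × Bool) : ℂ :=
  if p.2 then -w.du p.1 (G.len p.1) else w.du p.1 0

/-- Continuity at all vertices. -/
def ContinuousAtVertices (w : W22 G) : Prop :=
  ∀ p q, G.vtx p = G.vtx q → w.trace p = w.trace q

open Classical in
/-- The sum of the oriented derivatives over all end points belonging to the vertex `m`. -/
noncomputable def flux (w : W22 G) (m : G.V) : ℂ :=
  ∑ p : G.E × Bool, if G.vtx p = m then w.normalDeriv p else 0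

/-- `w` has the value `a` at the vertex `m`. -/
def HasValueAt (w : W22 G) (m : G.V) (a : ℂ) : Prop :=
  ∀ p, G.vtx p = m → w.trace p = a

/-- Standard vertex conditions at all vertices. -/
def Standard (w : W22 G) : Prop :=
  w.ContinuousAtVertices ∧ ∀ m, w.flux m = 0

lemma intervalIntegrable_ddu (w : W22 G) (e : G.E) {x : ℝ} (hx : x ∈ Icc 0 (G.len e)) :
    IntervalIntegrable (w.ddu e) volume 0 x := by
  have h : IntegrableOn (w.ddu e) (Icc 0 (G.len e)) volume :=
    (w.memLp e).integrable (by norm_num)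
  rw [intervalIntegrable_iff_integrableOn_Icc_of_le hx.1]
  exact h.mono_set (Icc_subset_Icc_right hx.2)

lemma continuousOn_primitive {ℓ : ℝ} (hl : 0 < ℓ) {f F : ℝ → ℂ}
    (hf : IntervalIntegrable f volume 0 ℓ)
    (hF : ∀ x ∈ Icc 0 ℓ, F x = F 0 + ∫ t in (0 : ℝ)..x, f t) : ContinuousOn F (Icc 0 ℓ) := by
  have h := intervalIntegral.continuousOn_primitive_interval (μ := volume) (f := f) (a := 0) (b := ℓ)
    (by rw [uIcc_of_le hl.le]; rwa [intervalIntegrable_iff_integrableOn_Icc_of_le hl.le] at hf)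
  rw [uIcc_of_le hl.le] at h
  exact (continuousOn_const.add h).congr hF

lemma ae_eq_zero_of_primitive {ℓ : ℝ} (hl : 0 < ℓ) {f F : ℝ → ℂ}
    (hf : IntervalIntegrable f volume 0 ℓ)
    (hF : ∀ x ∈ Icc 0 ℓ, F x = F 0 + ∫ t in (0 : ℝ)..x, f t)
    (h0 : ∀ x ∈ Icc 0 ℓ, F x = 0) : f =ᵐ[volume.restrict (Icc 0 ℓ)] 0 := by
  rw [← restrict_Ioo_eq_restrict_Icc, Filter.EventuallyEq, ae_restrict_iff' measurableSet_Ioo]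
  filter_upwards [hf.ae_hasDerivAt_integral] with x hx hxm
  have hx' : x ∈ uIcc 0 ℓ := by rw [uIcc_of_le hl.le]; exact Ioo_subset_Icc_self hxm
  have h1 := hx hx' 0 (by simp)
  have h2 : HasDerivAt (fun y => ∫ t in (0 : ℝ)..y, f t) 0 x := by
    refine (hasDerivAt_const x (0 : ℂ)).congr_of_eventuallyEq ?_
    filter_upwards [Ioo_mem_nhds hxm.1 hxm.2] with y hy
    have hy' := Ioo_subset_Icc_self hy
    have := hF y hy'
    rw [h0 y hy', h0 0 ⟨le_rfl, hl.le⟩] at this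
    simpa using this.symm
  exact h1.unique h2

lemma continuousOn_du (w : W22 G) (e : G.E) : ContinuousOn (w.du e) (Icc 0 (G.len e)) :=
  continuousOn_primitive (G.len_pos e)
    (w.intervalIntegrable_ddu e ⟨(G.len_pos e).le, le_rfl⟩) (w.du_eq e)

lemma intervalIntegrable_du (w : W22 G) (e : G.E) {x : ℝ} (hx : x ∈ Icc 0 (G.len e)) :
    IntervalIntegrable (w.du e) volume 0 x :=
  ((w.continuousOn_du e).mono (by rw [uIcc_of_le hx.1]; exact Icc_subset_Icc_right hx.2)).intervalIntegrable

lemma continuousOn_u (w : W22 G) (e : G.E) : ContinuousOn (w.u e) (Icc 0 (G.len e)) :=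
  continuousOn_primitive (G.len_pos e)
    (w.intervalIntegrable_du e ⟨(G.len_pos e).le, le_rfl⟩) (w.u_eq e)

lemma eqOn_zero {ℓ : ℝ} (hl : 0 < ℓ) {f : ℝ → ℂ} (hf : ContinuousOn f (Icc 0 ℓ))
    (h : f =ᵐ[volume.restrict (Icc 0 ℓ)] 0) : ∀ x ∈ Icc 0 ℓ, f x = 0 :=
  fun _ hx => Measure.eqOn_Icc_of_ae_eq volume hl.ne h hf continuousOn_const hx

lemma du_eq_zero (w : W22 G) (e : G.E) (h : ∀ x ∈ Icc 0 (G.len e), w.u e x = 0) :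
    ∀ x ∈ Icc 0 (G.len e), w.du e x = 0 :=
  eqOn_zero (G.len_pos e) (w.continuousOn_du e) (ae_eq_zero_of_primitive (G.len_pos e)
    (w.intervalIntegrable_du e ⟨(G.len_pos e).le, le_rfl⟩) (w.u_eq e) h)

lemma ddu_ae_eq_zero (w : W22 G) (e : G.E) (h : w.u e =ᵐ[G.edgeMeasure e] 0) :
    w.ddu e =ᵐ[G.edgeMeasure e] 0 :=
  ae_eq_zero_of_primitive (G.len_pos e)
    (w.intervalIntegrable_ddu e ⟨(G.len_pos e).le, le_rfl⟩) (w.du_eq e)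
    (w.du_eq_zero e (eqOn_zero (G.len_pos e) (w.continuousOn_u e) h))

instance : Zero (W22 G) where
  zero :=
    { u := fun _ _ => 0, du := fun _ _ => 0, ddu := fun _ _ => 0
      memLp := fun _ => MemLp.zero'
      du_eq := by simp
      u_eq := by simp }

noncomputable instance : Add (W22 G) where
  add w z :=
    { u := fun e x => w.u e x + z.u e x
      du := fun e x => w.du e x + z.du e x
      ddu := fun e x => w.ddu e x + z.ddu e x
      memLp := fun e => (w.memLp e).add (z.memLp e)
      du_eq := fun e x hx => by
        rw [intervalIntegral.integral_add (w.intervalIntegrable_ddu e hx)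
          (z.intervalIntegrable_ddu e hx), w.du_eq e x hx, z.du_eq e x hx]
        ring
      u_eq := fun e x hx => by
        rw [intervalIntegral.integral_add (w.intervalIntegrable_du e hx)
          (z.intervalIntegrable_du e hx), w.u_eq e x hx, z.u_eq e x hx]
        ring }

noncomputable instance : SMul ℂ (W22 G) where
  smul a w :=
    { u := fun e x => a * w.u e x
      du := fun e x => a * w.du e x
      ddu := fun e x => a * w.ddu e x
      memLp := fun e => (w.memLp e).const_mul a
      du_eq := fun e x hx => by
        rw [intervalIntegral.integral_const_mul, w.du_eq e x hx]
        ring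
      u_eq := fun e x hx => by
        rw [intervalIntegral.integral_const_mul, w.u_eq e x hx]
        ring }

@[simp] lemma zero_u (e : G.E) (x : ℝ) : (0 : W22 G).u e x = 0 := rfl
@[simp] lemma zero_ddu (e : G.E) (x : ℝ) : (0 : W22 G).ddu e x = 0 := rfl
@[simp] lemma add_u (w z : W22 G) (e : G.E) (x : ℝ) : (w + z).u e x = w.u e x + z.u e x := rfl
@[simp] lemma add_ddu (w z : W22 G) (e : G.E) (x : ℝ) :
    (w + z).ddu e x = w.ddu e x + z.ddu e x := rfl
@[simp] lemma smul_u (a : ℂ) (w : W22 G) (e : G.E) (x : ℝ) : (a • w).u e x = a * w.u e x := rfl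
@[simp] lemma smul_ddu (a : ℂ) (w : W22 G) (e : G.E) (x : ℝ) :
    (a • w).ddu e x = a * w.ddu e x := rfl

@[simp] lemma trace_zero (p : G.E × Bool) : (0 : W22 G).trace p = 0 := rfl
@[simp] lemma trace_add (w z : W22 G) (p : G.E × Bool) :
    (w + z).trace p = w.trace p + z.trace p := rfl
@[simp] lemma trace_smul (a : ℂ) (w : W22 G) (p : G.E × Bool) :
    (a • w).trace p = a * w.trace p := rfl

@[simp] lemma normalDeriv_zero (p : G.E × Bool) : (0 : W22 G).normalDeriv p = 0 := by
  have h : ∀ x, (0 : W22 G).du p.1 x = 0 := fun _ => rfl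
  simp [normalDeriv, h]
@[simp] lemma normalDeriv_add (w z : W22 G) (p : G.E × Bool) :
    (w + z).normalDeriv p = w.normalDeriv p + z.normalDeriv p := by
  have h : ∀ x, (w + z).du p.1 x = w.du p.1 x + z.du p.1 x := fun _ => rfl
  unfold normalDeriv
  split_ifs <;> rw [h]
  ring
@[simp] lemma normalDeriv_smul (a : ℂ) (w : W22 G) (p : G.E × Bool) :
    (a • w).normalDeriv p = a * w.normalDeriv p := by
  have h : ∀ x, (a • w).du p.1 x = a * w.du p.1 x := fun _ => rfl
  unfold normalDeriv
  split_ifs <;> rw [h]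
  ring

@[simp] lemma flux_zero (m : G.V) : (0 : W22 G).flux m = 0 := by simp [flux]
@[simp] lemma flux_add (w z : W22 G) (m : G.V) : (w + z).flux m = w.flux m + z.flux m := by
  classical
  unfold flux
  rw [← Finset.sum_add_distrib]
  refine Finset.sum_congr rfl fun p _ => ?_
  split_ifs <;> simp
@[simp] lemma flux_smul (a : ℂ) (w : W22 G) (m : G.V) : (a • w).flux m = a * w.flux m := by
  classical
  unfold flux
  rw [Finset.mul_sum]
  refine Finset.sum_congr rfl fun p _ => ?_
  split_ifs <;> simp

lemma ContinuousAtVertices.add {w z : W22 G} (hw : w.ContinuousAtVertices)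
    (hz : z.ContinuousAtVertices) : (w + z).ContinuousAtVertices := fun p q h => by
  simp [hw p q h, hz p q h]
lemma ContinuousAtVertices.smul (a : ℂ) {w : W22 G} (hw : w.ContinuousAtVertices) :
    (a • w).ContinuousAtVertices := fun p q h => by
  simp [hw p q h]

end W22

/-- The graph of the standard Laplacian `L`: the pairs `(f, g)` with `f` in the domain of `L`, i.e.
in `W₂²` on every edge and subject to the standard vertex conditions, and `g = L f = -f''`. -/
noncomputable def laplacianGraph (G : MetricGraph.{u}) : Submodule ℂ (L2 G × L2 G) where
  carrier := {fg | ∃ w : W22 G, w.Standard ∧ ∀ e,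
    fg.1 e =ᵐ[G.edgeMeasure e] w.u e ∧ fg.2 e =ᵐ[G.edgeMeasure e] fun x => -w.ddu e x}
  zero_mem' := by
    refine ⟨0, ⟨fun p q _ => by simp, fun m => by simp⟩, fun e => ⟨?_, ?_⟩⟩
    · filter_upwards [Lp.coeFn_zero ℂ 2 (G.edgeMeasure e)] with x hx
      simpa using hx
    · filter_upwards [Lp.coeFn_zero ℂ 2 (G.edgeMeasure e)] with x hx
      simpa using hx
  add_mem' := by
    rintro ⟨f, g⟩ ⟨f', g'⟩ ⟨w, hw, h⟩ ⟨w', hw', h'⟩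
    refine ⟨w + w', ⟨hw.1.add hw'.1, fun m => by simp [hw.2, hw'.2]⟩, fun e => ⟨?_, ?_⟩⟩
    · filter_upwards [Lp.coeFn_add (f e) (f' e), (h e).1, (h' e).1] with x hx h1 h2
      simp only [Pi.add_apply] at hx
      simp only [Prod.mk_add_mk, PiLp.add_apply, W22.add_u]
      rw [hx, ← h1, ← h2]
    · filter_upwards [Lp.coeFn_add (g e) (g' e), (h e).2, (h' e).2] with x hx h1 h2
      simp only [Pi.add_apply] at hx
      simp only [Prod.mk_add_mk, PiLp.add_apply, W22.add_ddu]
      rw [hx, neg_add, ← h1, ← h2]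
  smul_mem' := by
    rintro a ⟨f, g⟩ ⟨w, hw, h⟩
    refine ⟨a • w, ⟨hw.1.smul a, fun m => by simp [hw.2]⟩, fun e => ⟨?_, ?_⟩⟩
    · filter_upwards [Lp.coeFn_smul a (f e), (h e).1] with x hx h1
      simp only [Pi.smul_apply, smul_eq_mul] at hx
      simp only [Prod.smul_mk, PiLp.smul_apply, W22.smul_u]
      rw [hx, ← h1]
    · filter_upwards [Lp.coeFn_smul a (g e), (h e).2] with x hx h1
      simp only [Pi.smul_apply, smul_eq_mul] at hx
      simp only [Prod.smul_mk, PiLp.smul_apply, W22.smul_ddu]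
      rw [hx, ← mul_neg, ← h1]

lemma laplacianGraph_functional (G : MetricGraph.{u}) (x : L2 G × L2 G) (hx : x ∈ G.laplacianGraph)
    (h0 : x.1 = 0) : x.2 = 0 := by
  obtain ⟨f, g⟩ := x
  obtain ⟨w, -, h⟩ := hx
  simp only at h0 h ⊢
  subst h0
  ext1 e
  have h1 : w.u e =ᵐ[G.edgeMeasure e] 0 := by
    filter_upwards [(h e).1, Lp.coeFn_zero ℂ 2 (G.edgeMeasure e)] with x h1 h2
    rw [← h1]
    exact h2
  refine (Lp.eq_zero_iff_ae_eq_zero).2 ?_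
  filter_upwards [(h e).2, w.ddu_ae_eq_zero e h1] with x h2 h3
  rw [h2, h3]
  simp

/-- The standard Laplacian `L = -d²/dx²`, as an unbounded operator in `L₂(Γ)`. -/
noncomputable def laplacian (G : MetricGraph.{u}) : L2 G →ₗ.[ℂ] L2 G :=
  G.laplacianGraph.toLinearPMap

lemma laplacian_graph (G : MetricGraph.{u}) : G.laplacian.graph = G.laplacianGraph :=
  Submodule.toLinearPMap_graph_eq _ G.laplacianGraph_functional

/-- The eigenspace of the standard Laplacian for `μ`; its dimension is the multiplicity of `μ` in
the spectrum (and is zero if `μ` is not an eigenvalue). -/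
noncomputable def eigenspace (G : MetricGraph.{u}) (μ : ℂ) : Submodule ℂ (L2 G) :=
  (G.laplacian.toFun - μ • G.laplacian.domain.subtype).ker.map G.laplacian.domain.subtype

lemma mem_eigenspace (G : MetricGraph.{u}) (μ : ℂ) (f : L2 G) :
    f ∈ G.eigenspace μ ↔ (f, μ • f) ∈ G.laplacianGraph := by
  rw [← laplacian_graph, LinearPMap.mem_graph_iff]
  simp only [eigenspace, Submodule.mem_map, LinearMap.mem_ker, LinearMap.sub_apply,
    LinearMap.smul_apply, Submodule.subtype_apply, sub_eq_zero]
  constructor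
  · rintro ⟨y, hy, rfl⟩
    exact ⟨y, rfl, hy⟩
  · rintro ⟨y, rfl, hy⟩
    exact ⟨y, hy, rfl⟩

/-- Two metric graphs are isospectral if the spectra of their standard Laplacians (which consist of
eigenvalues) agree as multisets, i.e. every number has the same multiplicity for both. -/
def Isospectral (G₁ G₂ : MetricGraph.{u}) : Prop :=
  ∀ μ : ℂ, Module.rank ℂ (G₁.eigenspace μ) = Module.rank ℂ (G₂.eigenspace μ)

namespace W22

variable {G : MetricGraph.{u}}

/-- `w` solves the differential equation `-w'' = μ w` on all edges. -/
def IsSolution (w : W22 G) (μ : ℂ) : Prop :=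
  ∀ e, (fun x => -w.ddu e x) =ᵐ[G.edgeMeasure e] fun x => μ * w.u e x

end W22

section MFunction

variable {B : Type v} (G : MetricGraph.{u}) (c : B ↪ G.V)

/-- The pairs `(a, b)` of the values `a` and the sums `b` of oriented derivatives at the contact
vertices `c i`, `i : B`, of a solution of `-w'' = μ w` that is continuous at all vertices and
satisfies the standard conditions at all vertices which are not contact vertices. -/
def contactData (μ : ℂ) : Submodule ℂ ((B → ℂ) × (B → ℂ)) where
  carrier := {ab | ∃ w : W22 G, w.IsSolution μ ∧ w.ContinuousAtVertices ∧
    (∀ m, m ∉ range c → w.flux m = 0) ∧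
    (∀ i, w.HasValueAt (c i) (ab.1 i)) ∧ ∀ i, w.flux (c i) = ab.2 i}
  zero_mem' := ⟨0, fun e => by simp, fun p q _ => by simp, fun m _ => by simp,
    fun i p _ => by simp, fun i => by simp⟩
  add_mem' := by
    rintro ⟨a, b⟩ ⟨a', b'⟩ ⟨w, h1, h2, h3, h4, h5⟩ ⟨w', h1', h2', h3', h4', h5'⟩
    refine ⟨w + w', fun e => ?_, h2.add h2', fun m hm => by simp [h3 m hm, h3' m hm],
      fun i p hp => by simp [h4 i p hp, h4' i p hp], fun i => by simp [h5 i, h5' i]⟩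
    filter_upwards [h1 e, h1' e] with x hx hx'
    simp only [W22.add_ddu, W22.add_u]
    rw [neg_add, hx, hx', mul_add]
  smul_mem' := by
    rintro r ⟨a, b⟩ ⟨w, h1, h2, h3, h4, h5⟩
    refine ⟨r • w, fun e => ?_, h2.smul r, fun m hm => by simp [h3 m hm],
      fun i p hp => by simp [h4 i p hp], fun i => by simp [h5 i]⟩
    filter_upwards [h1 e] with x hx
    simp only [W22.smul_ddu, W22.smul_u]
    rw [← mul_neg, hx]
    ring

end MFunction

namespace W22

variable {G : MetricGraph.{u}}

lemma sum_normalDeriv (w : W22 G) (h : ∀ p : G.E × Bool, w.trace p = 0 ∨ w.flux (G.vtx p) = 0)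
    (hc : w.ContinuousAtVertices) :
    ∑ p : G.E × Bool, (starRingEnd ℂ) (w.trace p) * w.normalDeriv p = 0 := by
  classical
  rw [← Finset.sum_fiberwise_of_maps_to (s := Finset.univ) (t := Finset.univ.image G.vtx)
    (g := G.vtx) (fun p hp => Finset.mem_image_of_mem _ hp)]
  refine Finset.sum_eq_zero fun m hm => ?_
  obtain ⟨q, -, rfl⟩ := Finset.mem_image.1 hm
  have : ∑ p with G.vtx p = G.vtx q, (starRingEnd ℂ) (w.trace p) * w.normalDeriv p
      = (starRingEnd ℂ) (w.trace q) * w.flux (G.vtx q) := by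
    rw [flux, Finset.mul_sum, Finset.sum_filter]
    refine Finset.sum_congr rfl fun p _ => ?_
    split_ifs with hp
    · rw [hc p q hp]
    · simp
  rw [this]
  rcases h q with h | h <;> simp [h]

lemma green_edge (w : W22 G) {μ : ℂ} (hw : w.IsSolution μ) (e : G.E) :
    -μ * ((∫ x in (0 : ℝ)..G.len e, Complex.normSq (w.u e x) : ℝ) : ℂ) =
      -((starRingEnd ℂ) (w.trace (e, true)) * w.normalDeriv (e, true)
        + (starRingEnd ℂ) (w.trace (e, false)) * w.normalDeriv (e, false))
      - ((∫ x in (0 : ℝ)..G.len e, Complex.normSq (w.du e x) : ℝ) : ℂ) := by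
  have hl := G.len_pos e
  have hcu := w.continuousOn_u e
  have hcd := w.continuousOn_du e
  have hd : ∀ x ∈ Icc 0 (G.len e), w.du e x = w.du e 0 + ∫ t in (0 : ℝ)..x, -μ * w.u e t := by
    intro x hx
    rw [w.du_eq e x hx]
    congr 1
    apply intervalIntegral.integral_congr_ae_restrict
    rw [uIoc_of_le hx.1]
    filter_upwards [ae_restrict_of_ae_restrict_of_subset
      (Ioc_subset_Icc_self.trans (Icc_subset_Icc_right hx.2)) (hw e)] with t ht
    rw [neg_mul, ← ht, neg_neg]
  have key : ∀ (f F : ℝ → ℂ), ContinuousOn f (Icc 0 (G.len e)) →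
      (∀ x ∈ Icc 0 (G.len e), F x = F 0 + ∫ t in (0 : ℝ)..x, f t) →
      ∀ x ∈ Ioo 0 (G.len e), HasDerivAt F (f x) x := by
    intro f F hf hF x hx
    have h1 : HasDerivAt (fun y => ∫ t in (0 : ℝ)..y, f t) (f x) x := by
      apply intervalIntegral.integral_hasDerivAt_right
      · exact (hf.mono (by
          rw [uIcc_of_le hx.1.le]; exact Icc_subset_Icc_right hx.2.le)).intervalIntegrable
      · exact (hf.mono Ioo_subset_Icc_self).stronglyMeasurableAtFilter isOpen_Ioo x hx
      · exact hf.continuousAt (Icc_mem_nhds hx.1 hx.2)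
    refine (h1.const_add (F 0)).congr_of_eventuallyEq ?_
    filter_upwards [Ioo_mem_nhds hx.1 hx.2] with y hy
    exact hF y (Ioo_subset_Icc_self hy)
  have hu' := key _ _ hcd (w.u_eq e)
  have hd' := key _ _ (continuousOn_const.mul hcu) hd
  have huI : uIcc 0 (G.len e) = Icc 0 (G.len e) := uIcc_of_le hl.le
  have hcj : Continuous (starRingEnd ℂ) := Complex.continuous_conj
  have ibp := intervalIntegral.integral_mul_deriv_eq_deriv_mul_of_hasDerivAt
    (a := 0) (b := G.len e) (u := fun x => (starRingEnd ℂ) (w.u e x)) (v := w.du e)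
    (u' := fun x => (starRingEnd ℂ) (w.du e x)) (v' := fun x => -μ * w.u e x)
    (by rw [huI]; exact hcj.comp_continuousOn hcu) (by rw [huI]; exact hcd)
    (by
      intro x hx
      rw [min_eq_left hl.le, max_eq_right hl.le] at hx
      exact (hu' x hx).star)
    (by
      intro x hx
      rw [min_eq_left hl.le, max_eq_right hl.le] at hx
      exact hd' x hx)
    (by
      apply ContinuousOn.intervalIntegrable
      rw [huI]; exact hcj.comp_continuousOn hcd)
    (by
      apply ContinuousOn.intervalIntegrable
      rw [huI]; exact continuousOn_const.mul hcu)
  have e1 : ∫ x in (0 : ℝ)..G.len e, (starRingEnd ℂ) (w.u e x) * (-μ * w.u e x)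
      = -μ * ((∫ x in (0 : ℝ)..G.len e, Complex.normSq (w.u e x) : ℝ) : ℂ) := by
    rw [← intervalIntegral.integral_ofReal, ← intervalIntegral.integral_const_mul]
    congr 1
    funext x
    rw [Complex.normSq_eq_conj_mul_self]
    ring
  have e2 : ∫ x in (0 : ℝ)..G.len e, (starRingEnd ℂ) (w.du e x) * w.du e x
      = ((∫ x in (0 : ℝ)..G.len e, Complex.normSq (w.du e x) : ℝ) : ℂ) := by
    rw [← intervalIntegral.integral_ofReal]
    congr 1
    funext x
    rw [Complex.normSq_eq_conj_mul_self]
  rw [e1, e2] at ibp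
  rw [ibp]
  simp only [trace, normalDeriv, if_true, Bool.false_eq_true, if_false]
  ring

/-- For nonreal `μ`, the Laplacian with Dirichlet or standard conditions at each of the vertices
does not have the eigenvalue `μ`. -/
lemma eq_zero_of_nonreal (w : W22 G) {μ : ℂ} (hm : μ.im ≠ 0) (hw : w.IsSolution μ)
    (hc : w.ContinuousAtVertices)
    (h : ∀ p : G.E × Bool, w.trace p = 0 ∨ w.flux (G.vtx p) = 0) (e : G.E) :
    ∀ x ∈ Icc 0 (G.len e), w.u e x = 0 ∧ w.du e x = 0 := by
  have hs := w.sum_normalDeriv h hc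
  rw [Fintype.sum_prod_type] at hs
  simp only [Fintype.sum_bool] at hs
  have hg := Finset.sum_congr (rfl : (Finset.univ : Finset G.E) = Finset.univ)
    fun e _ => w.green_edge hw e
  rw [Finset.sum_sub_distrib, Finset.sum_neg_distrib, hs, neg_zero, zero_sub, ← Finset.mul_sum,
    ← Complex.ofReal_sum, ← Complex.ofReal_sum] at hg
  have him := congrArg Complex.im hg
  simp only [Complex.mul_im, Complex.neg_im, Complex.ofReal_im, Complex.ofReal_re, mul_zero,
    zero_add, neg_zero] at him
  have hsum : ∑ e : G.E, ∫ x in (0 : ℝ)..G.len e, Complex.normSq (w.u e x) = 0 := by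
    rcases mul_eq_zero.1 him with h | h
    · exact absurd (neg_eq_zero.1 h) hm
    · exact h
  have hnn : ∀ e ∈ (Finset.univ : Finset G.E),
      0 ≤ ∫ x in (0 : ℝ)..G.len e, Complex.normSq (w.u e x) := fun e _ =>
    intervalIntegral.integral_nonneg (G.len_pos e).le fun _ _ => Complex.normSq_nonneg _
  have he := (Finset.sum_eq_zero_iff_of_nonneg hnn).1 hsum e (Finset.mem_univ _)
  have hcont : ContinuousOn (fun x => Complex.normSq (w.u e x)) (Icc 0 (G.len e)) :=
    Complex.continuous_normSq.comp_continuousOn (w.continuousOn_u e)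
  have hu : ∀ x ∈ Icc 0 (G.len e), w.u e x = 0 := by
    rw [intervalIntegral.integral_eq_zero_iff_of_le_of_nonneg_ae (G.len_pos e).le
      (Filter.Eventually.of_forall fun _ => Complex.normSq_nonneg _)
      (ContinuousOn.intervalIntegrable (by rwa [uIcc_of_le (G.len_pos e).le]))] at he
    apply eqOn_zero (G.len_pos e) (w.continuousOn_u e)
    rw [← restrict_Ioc_eq_restrict_Icc]
    filter_upwards [he] with x hx
    exact Complex.normSq_eq_zero.1 hx
  exact fun x hx => ⟨hu x hx, w.du_eq_zero e hu x hx⟩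

lemma flux_eq_zero (w : W22 G) (h : ∀ e, ∀ x ∈ Icc 0 (G.len e), w.du e x = 0) (m : G.V) :
    w.flux m = 0 := by
  classical
  refine Finset.sum_eq_zero fun p _ => ?_
  have h0 := h p.1 0 ⟨le_rfl, (G.len_pos _).le⟩
  have h1 := h p.1 _ ⟨(G.len_pos _).le, le_rfl⟩
  simp [normalDeriv, h0, h1]

end W22

section MFunction

variable {B : Type v} (G : MetricGraph.{u}) (c : B ↪ G.V)

lemma contactData_functional {μ : ℂ} (hm : μ.im ≠ 0) (x : (B → ℂ) × (B → ℂ))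
    (hx : x ∈ G.contactData c μ) (h0 : x.1 = 0) : x.2 = 0 := by
  obtain ⟨w, h1, h2, h3, h4, h5⟩ := hx
  have h := w.eq_zero_of_nonreal hm h1 h2 fun p => by
    by_cases hp : G.vtx p ∈ range c
    · obtain ⟨i, hi⟩ := hp
      left
      rw [h4 i p hi.symm, h0]
      rfl
    · exact Or.inr (h3 _ hp)
  funext i
  rw [← h5 i]
  exact w.flux_eq_zero (fun e x hx => (h e x hx).2) _

instance (G : MetricGraph.{u}) : Finite G.V := Finite.of_surjective _ G.vtx_surj

lemma hasDerivAt_cos (k : ℂ) (x : ℝ) :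
    HasDerivAt (fun t : ℝ => Complex.cos (k * t)) (-Complex.sin (k * x) * k) x := by
  simpa using ((((hasDerivAt_id (x : ℂ)).const_mul k).ccos).comp_ofReal)

lemma hasDerivAt_sin (k : ℂ) (x : ℝ) :
    HasDerivAt (fun t : ℝ => Complex.sin (k * t)) (Complex.cos (k * x) * k) x := by
  simpa using ((((hasDerivAt_id (x : ℂ)).const_mul k).csin).comp_ofReal)

/-- The solution `α cos k x + β sin k x` of `-w'' = k² w`, with coefficients depending on the
edge. -/
noncomputable def trig (k : ℂ) (s : G.E → ℂ × ℂ) : W22 G where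
  u e x := (s e).1 * Complex.cos (k * x) + (s e).2 * Complex.sin (k * x)
  du e x := (s e).1 * (-Complex.sin (k * x) * k) + (s e).2 * (Complex.cos (k * x) * k)
  ddu e x := -(k ^ 2 * ((s e).1 * Complex.cos (k * x) + (s e).2 * Complex.sin (k * x)))
  memLp e := by
    have hc : Continuous fun x : ℝ =>
        -(k ^ 2 * ((s e).1 * Complex.cos (k * x) + (s e).2 * Complex.sin (k * x))) := by fun_prop
    obtain ⟨C, hC⟩ := (isCompact_Icc (a := (0 : ℝ)) (b := G.len e)).exists_bound_of_continuousOn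
      hc.continuousOn
    exact MemLp.of_bound hc.aestronglyMeasurable C
      ((ae_restrict_iff' measurableSet_Icc).2 (Filter.Eventually.of_forall hC))
  du_eq e x _ := by
    rw [intervalIntegral.integral_eq_sub_of_hasDerivAt
      (f := fun x : ℝ => (s e).1 * (-Complex.sin (k * x) * k) + (s e).2 * (Complex.cos (k * x) * k))]
    · ring
    · intro t _
      refine (((hasDerivAt_sin k t).neg.mul_const k).const_mul _
        |>.add (((hasDerivAt_cos k t).mul_const k).const_mul _)).congr_deriv ?_
      ring
    · exact Continuous.intervalIntegrable (by fun_prop) _ _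
  u_eq e x _ := by
    rw [intervalIntegral.integral_eq_sub_of_hasDerivAt
      (f := fun x : ℝ => (s e).1 * Complex.cos (k * x) + (s e).2 * Complex.sin (k * x))]
    · ring
    · intro t _
      exact ((hasDerivAt_cos k t).const_mul _).add ((hasDerivAt_sin k t).const_mul _)
    · exact Continuous.intervalIntegrable (by fun_prop) _ _

lemma trig_add (k : ℂ) (s t : G.E → ℂ × ℂ) :
    (G.trig k (s + t)).trace = (G.trig k s).trace + (G.trig k t).trace ∧
    (G.trig k (s + t)).flux = (G.trig k s).flux + (G.trig k t).flux := by
  classical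
  constructor
  · funext p
    simp only [W22.trace, trig, Pi.add_apply, Prod.fst_add, Prod.snd_add]
    ring
  · funext m
    rw [Pi.add_apply, ← W22.flux_add]
    refine Finset.sum_congr rfl fun p _ => ?_
    rw [W22.normalDeriv_add]
    simp only [W22.normalDeriv, trig, Pi.add_apply, Prod.fst_add, Prod.snd_add]
    split_ifs <;> ring

lemma trig_smul (k r : ℂ) (s : G.E → ℂ × ℂ) :
    (G.trig k (r • s)).trace = r • (G.trig k s).trace ∧
    (G.trig k (r • s)).flux = r • (G.trig k s).flux := by
  classical
  constructor
  · funext p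
    simp only [W22.trace, trig, Pi.smul_apply, Prod.smul_fst, Prod.smul_snd, smul_eq_mul]
    ring
  · funext m
    rw [Pi.smul_apply, smul_eq_mul, ← W22.flux_smul]
    refine Finset.sum_congr rfl fun p _ => ?_
    rw [W22.normalDeriv_smul]
    simp only [W22.normalDeriv, trig, Pi.smul_apply, Prod.smul_fst, Prod.smul_snd, smul_eq_mul]
    split_ifs <;> ring

lemma exists_contactData {μ : ℂ} (hm : μ.im ≠ 0) (a : B → ℂ) :
    ∃ b, (a, b) ∈ G.contactData c μ := by
  classical
  have := Fintype.ofFinite G.V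
  obtain ⟨k, hk⟩ := IsSquare.exists_sq μ (IsAlgClosed.exists_pow_nat_eq μ (n := 2) (by norm_num)
    |>.elim fun z hz => ⟨z, by rw [← hz, sq]⟩)
  have hk0 : k ≠ 0 := by
    rintro rfl
    simp [hk] at hm
  have hsol : ∀ s, (G.trig k s).IsSolution μ := fun s e =>
    Filter.Eventually.of_forall fun x => by simp [trig, hk]
  let T : ((G.E → ℂ × ℂ) × (G.V → ℂ)) →ₗ[ℂ] ((G.E × Bool → ℂ) × (G.V → ℂ)) :=
    { toFun := fun x => (fun p => (G.trig k x.1).trace p - x.2 (G.vtx p),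
        fun m => if m ∈ range c then x.2 m else (G.trig k x.1).flux m)
      map_add' := fun x y => by
        refine Prod.ext (funext fun p => ?_) (funext fun m => ?_)
        · simp only [Prod.fst_add, Prod.snd_add, (G.trig_add k _ _).1, Pi.add_apply]
          ring
        · simp only [Prod.fst_add, Prod.snd_add, (G.trig_add k _ _).2, Pi.add_apply]
          split_ifs <;> rfl
      map_smul' := fun r x => by
        refine Prod.ext (funext fun p => ?_) (funext fun m => ?_)
        · simp only [Prod.smul_fst, Prod.smul_snd, (G.trig_smul k r _).1, Pi.smul_apply,
            smul_eq_mul, RingHom.id_apply]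
          ring
        · simp only [Prod.smul_fst, Prod.smul_snd, (G.trig_smul k r _).2, Pi.smul_apply,
            smul_eq_mul, RingHom.id_apply]
          split_ifs <;> rfl }
  have hT : Function.Injective T := by
    rw [← LinearMap.ker_eq_bot, LinearMap.ker_eq_bot']
    rintro ⟨s, y⟩ h
    have hp : ∀ p, (G.trig k s).trace p = y (G.vtx p) := fun p =>
      sub_eq_zero.1 (congrFun (congrArg Prod.fst h) p)
    have hv : ∀ m, (if m ∈ range c then y m else (G.trig k s).flux m) = 0 := fun m =>
      congrFun (congrArg Prod.snd h) m
    have h0 := (G.trig k s).eq_zero_of_nonreal hm (hsol s)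
      (fun p q hpq => by rw [hp, hp, hpq])
      (fun p => by
        have := hv (G.vtx p)
        split_ifs at this with hr
        · exact Or.inl (by rw [hp, this])
        · exact Or.inr this)
    have hs : s = 0 := by
      funext e
      have h1 := h0 e 0 ⟨le_rfl, (G.len_pos e).le⟩
      simp only [trig, Complex.ofReal_zero, mul_zero, Complex.cos_zero, Complex.sin_zero] at h1
      refine Prod.ext ?_ ?_
      · simpa using h1.1
      · simpa [hk0] using h1.2
    have hy : y = 0 := by
      funext m
      obtain ⟨p, rfl⟩ := G.vtx_surj m
      rw [← hp, hs]
      simp [W22.trace, trig]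
    rw [hs, hy]
    rfl
  have hdim : Module.finrank ℂ ((G.E → ℂ × ℂ) × (G.V → ℂ))
      = Module.finrank ℂ ((G.E × Bool → ℂ) × (G.V → ℂ)) := by
    simp [Module.finrank_pi_fintype]
  obtain ⟨⟨s, y⟩, hsy⟩ := (LinearMap.injective_iff_surjective_of_finrank_eq_finrank hdim).1 hT
    (0, fun m => if h : ∃ i, c i = m then a h.choose else 0)
  have hp : ∀ p, (G.trig k s).trace p = y (G.vtx p) := fun p =>
    sub_eq_zero.1 (congrFun (congrArg Prod.fst hsy) p)
  have hv : ∀ m, (if m ∈ range c then y m else (G.trig k s).flux m)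
      = if h : ∃ i, c i = m then a h.choose else 0 := fun m =>
    congrFun (congrArg Prod.snd hsy) m
  refine ⟨fun i => (G.trig k s).flux (c i), G.trig k s, hsol s, fun p q hpq => by rw [hp, hp, hpq],
    fun m hr => ?_, fun i p hi => ?_, fun i => rfl⟩
  · have := hv m
    rw [if_neg hr, dif_neg (by simpa using hr)] at this
    exact this
  · have h1 := hv (c i)
    have hex : ∃ j, c j = c i := ⟨i, rfl⟩
    rw [if_pos (mem_range_self i), dif_pos hex, c.injective hex.choose_spec] at h1
    rw [hp, hi, h1]

/-- The Titchmarsh-Weyl `M`-function of `G` with the contact vertices `c i`, `i : B`, at a nonreal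
`μ`: the linear map (matrix) taking the values on the contact vertices of a solution of `-w'' = μ w`
to its sums of oriented derivatives there. -/
noncomputable def mFunction (μ : ℂ) (hm : μ.im ≠ 0) : (B → ℂ) →ₗ[ℂ] (B → ℂ) where
  toFun a := (G.exists_contactData c hm a).choose
  map_add' a a' := by
    refine sub_eq_zero.1 (G.contactData_functional c hm
      (a + a' - (a + a'), _) ?_ (sub_self _))
    exact Submodule.sub_mem _ (G.exists_contactData c hm (a + a')).choose_spec
      (Submodule.add_mem _ (G.exists_contactData c hm a).choose_spec
        (G.exists_contactData c hm a').choose_spec)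
  map_smul' r a := by
    refine sub_eq_zero.1 (G.contactData_functional c hm
      (r • a - r • a, _) ?_ (sub_self _))
    exact Submodule.sub_mem _ (G.exists_contactData c hm (r • a)).choose_spec
      (Submodule.smul_mem _ r (G.exists_contactData c hm a).choose_spec)

lemma mFunction_eq_iff {μ : ℂ} (hm : μ.im ≠ 0) (a b : B → ℂ) :
    G.mFunction c μ hm a = b ↔ (a, b) ∈ G.contactData c μ := by
  have h := (G.exists_contactData c hm a).choose_spec
  constructor
  · rintro rfl
    exact h
  · intro hb
    refine sub_eq_zero.1 (G.contactData_functional c hm (a - a, _) ?_ (sub_self _))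
    exact Submodule.sub_mem _ h hb

end MFunction

/-- Two metric graphs with contact vertices labelled by the same set are Steklov-equivalent if
their `M`-functions are equal. -/
def SteklovEquivalent {B : Type v} (G₁ : MetricGraph.{u}) (c₁ : B ↪ G₁.V) (G₂ : MetricGraph.{u})
    (c₂ : B ↪ G₂.V) : Prop :=
  ∀ (μ : ℂ) (hm : μ.im ≠ 0), G₁.mFunction c₁ μ hm = G₂.mFunction c₂ μ hm

/-- The pairs of vertices identified when gluing: the contact vertex `c i` of `R` and the vertex
`m` of `K`, for every pair `(i, m)` in `P`. -/
inductive GlueRel {B : Type v} (K R : MetricGraph.{u}) (c : B ↪ R.V) (P : Set (B × K.V)) :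
    K.V ⊕ R.V → K.V ⊕ R.V → Prop
  | mk (i : B) (m : K.V) (h : (i, m) ∈ P) : GlueRel K R c P (Sum.inl m) (Sum.inr (c i))

/-- The metric graph obtained by gluing `K` and `R`: the edges are those of `K` and of `R`, and the
contact vertex `c i` of `R` is identified with the vertex `m` of `K` for every pair `(i, m)` in `P`
(`Quot` is the quotient by the equivalence relation generated by these identifications). -/
def glue {B : Type v} (K R : MetricGraph.{u}) (c : B ↪ R.V) (P : Set (B × K.V)) :
    MetricGraph.{u} where
  E := K.E ⊕ R.E
  V := Quot (GlueRel K R c P)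
  len := Sum.elim K.len R.len
  len_pos := by
    rintro (e | e)
    · exact K.len_pos e
    · exact R.len_pos e
  vtx p := Quot.mk _ (p.1.elim (fun e => Sum.inl (K.vtx (e, p.2))) fun e => Sum.inr (R.vtx (e, p.2)))
  vtx_surj := by
    rintro ⟨m | m⟩
    · obtain ⟨⟨e, s⟩, rfl⟩ := K.vtx_surj m
      exact ⟨(Sum.inl e, s), rfl⟩
    · obtain ⟨⟨e, s⟩, rfl⟩ := R.vtx_surj m
      exact ⟨(Sum.inr e, s), rfl⟩

end MetricGraph

/-! Fix `μ = k ^ 2`. On every edge a solution of `-u'' = μ u` is determined by its initial data, so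
eigenspaces become finite-dimensional spaces of initial data and isospectrality becomes an equality
of natural numbers for every `μ`.

Consider on `R` the solutions that satisfy all conditions except those on the sums of derivatives at
the contact vertices. Map each to its boundary data `(a, b)`: values and sums of derivatives at the
contact vertices. The kernel `N` consists of the solutions that cannot be seen from the contact
vertices, the image is the space `C` of boundary data. The multiplicity of `μ` is a dimension cut
out by conditions on `(a, b)` alone. Rank-nullity therefore gives `dim N + dim (C ∩ {b = 0})` for
`R` (`finrank_standardData`), and `dim N` plus the dimension of a space depending only on `K`, `P`
and `C` for the glued graph (`finrank_standardData_glue`). Once `C` is the same for both graphs,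
isospectrality of `R₁` and `R₂` equates the numbers `dim N`, and the two glued graphs have equal
multiplicities.

Steklov-equivalence says that `C`, the graph of the `M`-function, is the same for nonreal `μ`,
whereas eigenvalues are real and the `M`-function may have poles there.
`SteklovEquivalent.contactData_eq` bridges this gap. For `Im μ ≤ 0` the problem `b - i a = g` has at
most one solution `(a, b)` in `C`, with `‖a‖ ≤ ‖g‖` in the Euclidean norm, and for `Im μ < 0` it has
one. So any boundary datum at a real `μ` is a limit of boundary data at nonreal points, which are
common to both graphs, and such limits stay in the space of boundary data
(`mem_contactData_of_tendsto`). -/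

namespace MetricGraph

/-! ### Fundamental solutions that remain valid at `k = 0` -/

/-- The solution `sin (k x) / k` of `-w'' = k² w`, in a form that makes sense for `k = 0`. -/
noncomputable def sineOver (k : ℂ) (x : ℝ) : ℂ := ∫ t in (0 : ℝ)..x, Complex.cos (k * t)

lemma hasDerivAt_sineOver (k : ℂ) (x : ℝ) : HasDerivAt (sineOver k) (Complex.cos (k * x)) x := by
  have hc : Continuous fun t : ℝ => Complex.cos (k * t) := by fun_prop
  exact intervalIntegral.integral_hasDerivAt_right (hc.intervalIntegrable _ _)
    hc.stronglyMeasurable.stronglyMeasurableAtFilter hc.continuousAt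

lemma mul_sineOver (k : ℂ) (x : ℝ) : k * sineOver k x = Complex.sin (k * x) := by
  rw [sineOver, ← intervalIntegral.integral_const_mul,
    intervalIntegral.integral_eq_sub_of_hasDerivAt (f := fun t : ℝ => Complex.sin (k * t))]
  · simp
  · intro t _
    exact (hasDerivAt_sin k t).congr_deriv (mul_comm _ _)
  · exact Continuous.intervalIntegrable (by fun_prop) _ _

@[fun_prop]
lemma continuous_sineOver_right (k : ℂ) : Continuous (sineOver k) :=
  continuous_iff_continuousAt.2 fun x => (hasDerivAt_sineOver k x).continuousAt

lemma continuous_sineOver : Continuous fun q : ℂ × ℝ => sineOver q.1 q.2 :=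
  intervalIntegral.continuous_parametric_intervalIntegral_of_continuous
    (f := fun (q : ℂ × ℝ) (t : ℝ) => Complex.cos (q.1 * t)) (by
      unfold Function.uncurry
      fun_prop) continuous_snd

variable {G : MetricGraph.{u}}

lemma W22.ext {w z : W22 G} (h : w.u = z.u) (h' : w.du = z.du) (h'' : w.ddu = z.ddu) : w = z := by
  cases w
  cases z
  simp only at h h' h''
  subst h h' h''
  rfl

/-- The solution of `-w'' = k² w` with the initial data `s` at the left end points of the edges. -/
noncomputable def solution (k : ℂ) (s : G.E → ℂ × ℂ) : W22 G where
  u e x := (s e).1 * Complex.cos (k * x) + (s e).2 * sineOver k x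
  du e x := (s e).1 * (-Complex.sin (k * x) * k) + (s e).2 * Complex.cos (k * x)
  ddu e x := -(k ^ 2 * ((s e).1 * Complex.cos (k * x) + (s e).2 * sineOver k x))
  memLp e := by
    have hc : Continuous fun x : ℝ =>
        -(k ^ 2 * ((s e).1 * Complex.cos (k * x) + (s e).2 * sineOver k x)) := by
      fun_prop
    obtain ⟨C, hC⟩ := (isCompact_Icc (a := (0 : ℝ)) (b := G.len e)).exists_bound_of_continuousOn
      hc.continuousOn
    exact MemLp.of_bound hc.aestronglyMeasurable C
      ((ae_restrict_iff' measurableSet_Icc).2 (Filter.Eventually.of_forall hC))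
  du_eq e x _ := by
    rw [intervalIntegral.integral_eq_sub_of_hasDerivAt
      (f := fun x : ℝ => (s e).1 * (-Complex.sin (k * x) * k) + (s e).2 * Complex.cos (k * x))]
    · ring
    · intro t _
      refine (((hasDerivAt_sin k t).neg.mul_const k).const_mul _
        |>.add ((hasDerivAt_cos k t).const_mul _)).congr_deriv ?_
      rw [← mul_sineOver]
      ring
    · exact Continuous.intervalIntegrable (by fun_prop) _ _
  u_eq e x _ := by
    rw [intervalIntegral.integral_eq_sub_of_hasDerivAt
      (f := fun x : ℝ => (s e).1 * Complex.cos (k * x) + (s e).2 * sineOver k x)]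
    · ring
    · intro t _
      exact ((hasDerivAt_cos k t).const_mul _).add ((hasDerivAt_sineOver k t).const_mul _)
    · exact Continuous.intervalIntegrable (by fun_prop) _ _

lemma isSolution_solution (k : ℂ) (s : G.E → ℂ × ℂ) : (solution k s).IsSolution (k ^ 2) :=
  fun _ => Filter.Eventually.of_forall fun _ => by simp [solution]

lemma hasDerivAt_solution_u (k : ℂ) (s : G.E → ℂ × ℂ) (e : G.E) (x : ℝ) :
    HasDerivAt ((solution k s).u e) ((solution k s).du e x) x :=
  ((hasDerivAt_cos k x).const_mul _).add ((hasDerivAt_sineOver k x).const_mul _)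

lemma hasDerivAt_solution_du (k : ℂ) (s : G.E → ℂ × ℂ) (e : G.E) (x : ℝ) :
    HasDerivAt ((solution k s).du e) (-k ^ 2 * (solution k s).u e x) x := by
  refine (((hasDerivAt_sin k x).neg.mul_const k).const_mul _
    |>.add ((hasDerivAt_cos k x).const_mul _)).congr_deriv ?_
  rw [← mul_sineOver]
  simp only [solution]
  ring

lemma solution_u_zero (k : ℂ) (s : G.E → ℂ × ℂ) (e : G.E) : (solution k s).u e 0 = (s e).1 := by
  simp [solution, sineOver]

lemma solution_du_zero (k : ℂ) (s : G.E → ℂ × ℂ) (e : G.E) : (solution k s).du e 0 = (s e).2 := by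
  simp [solution]

lemma solution_add (k : ℂ) (s t : G.E → ℂ × ℂ) :
    solution k (s + t) = solution k s + solution k t := by
  refine W22.ext ?_ ?_ ?_ <;> funext e x
  · change _ = (solution k s).u e x + (solution k t).u e x
    simp only [solution, Pi.add_apply, Prod.fst_add, Prod.snd_add]
    ring
  · change _ = (solution k s).du e x + (solution k t).du e x
    simp only [solution, Pi.add_apply, Prod.fst_add, Prod.snd_add]
    ring
  · change _ = (solution k s).ddu e x + (solution k t).ddu e x
    simp only [solution, Pi.add_apply, Prod.fst_add, Prod.snd_add]
    ring

lemma solution_smul (k r : ℂ) (s : G.E → ℂ × ℂ) :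
    solution k (r • s) = r • solution k s := by
  refine W22.ext ?_ ?_ ?_ <;> funext e x
  · change _ = r * (solution k s).u e x
    simp only [solution, Pi.smul_apply, Prod.smul_fst, Prod.smul_snd, smul_eq_mul]
    ring
  · change _ = r * (solution k s).du e x
    simp only [solution, Pi.smul_apply, Prod.smul_fst, Prod.smul_snd, smul_eq_mul]
    ring
  · change _ = r * (solution k s).ddu e x
    simp only [solution, Pi.smul_apply, Prod.smul_fst, Prod.smul_snd, smul_eq_mul]
    ring

lemma solution_zero (k : ℂ) : solution k (0 : G.E → ℂ × ℂ) = 0 := by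
  refine W22.ext ?_ ?_ ?_ <;> funext e x
  · change _ = (0 : ℂ)
    simp [solution]
  · change _ = (0 : ℂ)
    simp [solution]
  · change _ = (0 : ℂ)
    simp [solution]

lemma continuous_solution_u (e : G.E) :
    Continuous fun q : (ℂ × (G.E → ℂ × ℂ)) × ℝ => (solution q.1.1 q.1.2).u e q.2 := by
  have h : Continuous fun q : (ℂ × (G.E → ℂ × ℂ)) × ℝ => sineOver q.1.1 q.2 :=
    continuous_sineOver.comp (f := fun q : (ℂ × (G.E → ℂ × ℂ)) × ℝ => (q.1.1, q.2)) (by fun_prop)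
  simp only [solution]
  fun_prop

lemma continuous_solution_trace (p : G.E × Bool) :
    Continuous fun q : ℂ × (G.E → ℂ × ℂ) => (solution q.1 q.2).trace p :=
  (continuous_solution_u p.1).comp (Continuous.prodMk continuous_id continuous_const)

lemma continuous_solution_normalDeriv (p : G.E × Bool) :
    Continuous fun q : ℂ × (G.E → ℂ × ℂ) => (solution q.1 q.2).normalDeriv p := by
  simp only [W22.normalDeriv, solution]
  split_ifs <;> fun_prop

lemma continuous_solution_flux (m : G.V) :
    Continuous fun q : ℂ × (G.E → ℂ × ℂ) => (solution q.1 q.2).flux m := by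
  classical
  simp only [W22.flux]
  refine continuous_finsetSum _ fun p _ => ?_
  split_ifs
  · exact continuous_solution_normalDeriv p
  · exact continuous_const

/-! ### Uniqueness for the initial value problem -/

lemma hasDerivWithinAt_of_primitive {ℓ : ℝ} {f F : ℝ → ℂ} (hf : ContinuousOn f (Icc 0 ℓ))
    (hF : ∀ x ∈ Icc 0 ℓ, F x = F 0 + ∫ t in (0 : ℝ)..x, f t) {x : ℝ} (hx : x ∈ Ico 0 ℓ) :
    HasDerivWithinAt F (f x) (Ici x) x := by
  have hl : 0 ≤ ℓ := hx.1.trans hx.2.le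
  -- Extending `f` by constants makes it continuous on the line, so that the derivative exists at
  -- the end point `0` as well.
  have hg : Continuous (IccExtend hl ((Icc 0 ℓ).domRestrict f)) := hf.domRestrict.Icc_extend'
  have hgf : ∀ y ∈ Icc 0 ℓ, IccExtend hl ((Icc 0 ℓ).domRestrict f) y = f y := fun y hy => by
    rw [IccExtend_of_mem _ _ hy]
    rfl
  have h1 := (intervalIntegral.integral_hasDerivAt_right (a := 0) (b := x)
    (hg.intervalIntegrable _ _) hg.stronglyMeasurable.stronglyMeasurableAtFilter
    hg.continuousAt).const_add (F 0)
  rw [hgf x ⟨hx.1, hx.2.le⟩] at h1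
  have h2 : ∀ y ∈ Icc 0 ℓ, F y
      = F 0 + ∫ t in (0 : ℝ)..y, IccExtend hl ((Icc 0 ℓ).domRestrict f) t := fun y hy => by
    rw [hF y hy]
    congr 1
    refine intervalIntegral.integral_congr fun t ht => ?_
    rw [uIcc_of_le hy.1] at ht
    exact (hgf t ⟨ht.1, ht.2.trans hy.2⟩).symm
  refine h1.hasDerivWithinAt.congr_of_eventuallyEq ?_ (h2 x ⟨hx.1, hx.2.le⟩)
  filter_upwards [inter_mem_nhdsWithin (Ici x) (Iio_mem_nhds hx.2)] with y hy
  exact h2 y ⟨hx.1.trans hy.1, (le_of_lt hy.2)⟩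

namespace W22

/-- The equation holds only almost everywhere, which suffices under the integral. The new integrand
is continuous, so solutions are classical. -/
lemma IsSolution.du_eq {w : W22 G} {μ : ℂ} (hw : w.IsSolution μ) (e : G.E) {x : ℝ}
    (hx : x ∈ Icc 0 (G.len e)) : w.du e x = w.du e 0 + ∫ t in (0 : ℝ)..x, -μ * w.u e t := by
  rw [w.du_eq e x hx]
  congr 1
  apply intervalIntegral.integral_congr_ae_restrict
  rw [uIoc_of_le hx.1]
  filter_upwards [ae_restrict_of_ae_restrict_of_subset
    (Ioc_subset_Icc_self.trans (Icc_subset_Icc_right hx.2)) (hw e)] with t ht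
  rw [neg_mul, ← ht, neg_neg]

/-- Solutions of the differential equation are determined by their initial data. -/
lemma IsSolution.eq_solution {w : W22 G} {k : ℂ} (hw : w.IsSolution (k ^ 2)) (e : G.E) {x : ℝ}
    (hx : x ∈ Icc 0 (G.len e)) :
    w.u e x = (solution k fun e => (w.u e 0, w.du e 0)).u e x ∧
      w.du e x = (solution k fun e => (w.u e 0, w.du e 0)).du e x := by
  set z : W22 G := solution k fun e => (w.u e 0, w.du e 0) with hz
  let A : ℂ × ℂ →L[ℂ] ℂ × ℂ :=
    (ContinuousLinearMap.snd ℂ ℂ ℂ).prod (-k ^ 2 • ContinuousLinearMap.fst ℂ ℂ ℂ)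
  -- `A` is the first-order system `(u, u')' = (u', -k² u)`.
  have h := ODE_solution_unique (v := fun _ => A) (K := ‖A‖₊) (fun _ => A.lipschitz)
    (f := fun y => (w.u e y, w.du e y)) (g := fun y => (z.u e y, z.du e y))
    (a := 0) (b := G.len e)
    ((w.continuousOn_u e).prodMk (w.continuousOn_du e))
    (fun y hy => by
      have h1 := hasDerivWithinAt_of_primitive (w.continuousOn_du e) (w.u_eq e) hy
      have h2 := hasDerivWithinAt_of_primitive (continuousOn_const.mul (w.continuousOn_u e))
        (fun x hx => hw.du_eq e hx) hy
      exact h1.prodMk h2)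
    ((z.continuousOn_u e).prodMk (z.continuousOn_du e))
    (fun y _ => ((hasDerivAt_solution_u k _ e y).hasDerivWithinAt).prodMk
      (hasDerivAt_solution_du k _ e y).hasDerivWithinAt)
    (by rw [hz, solution_u_zero, solution_du_zero]) hx
  exact Prod.ext_iff.1 h

lemma IsSolution.trace_eq {w : W22 G} {k : ℂ} (hw : w.IsSolution (k ^ 2)) :
    (solution k fun e => (w.u e 0, w.du e 0)).trace = w.trace := by
  funext p
  refine ((hw.eq_solution p.1 ?_).1).symm
  split_ifs
  · exact ⟨(G.len_pos _).le, le_rfl⟩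
  · exact ⟨le_rfl, (G.len_pos _).le⟩

lemma IsSolution.normalDeriv_eq {w : W22 G} {k : ℂ} (hw : w.IsSolution (k ^ 2)) :
    (solution k fun e => (w.u e 0, w.du e 0)).normalDeriv = w.normalDeriv := by
  funext p
  unfold normalDeriv
  rw [← (hw.eq_solution p.1 ⟨le_rfl, (G.len_pos _).le⟩).2,
    ← (hw.eq_solution p.1 ⟨(G.len_pos _).le, le_rfl⟩).2]

lemma IsSolution.flux_eq {w : W22 G} {k : ℂ} (hw : w.IsSolution (k ^ 2)) :
    (solution k fun e => (w.u e 0, w.du e 0)).flux = w.flux := by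
  funext m
  unfold flux
  rw [hw.normalDeriv_eq]

lemma sum_mul_normalDeriv (w : W22 G) [Fintype G.V] (φ : G.V → ℂ) :
    ∑ p, φ (G.vtx p) * w.normalDeriv p = ∑ m, φ m * w.flux m := by
  classical
  simp only [flux, Finset.mul_sum]
  rw [Finset.sum_comm]
  refine Finset.sum_congr rfl fun p _ => ?_
  simp

end W22

/-! ### Green's formula and boundary data at the contact vertices -/

/-- Green's formula. -/
lemma green (k l : ℂ) (s t : G.E → ℂ × ℂ) :
    (k ^ 2 - (starRingEnd ℂ) (l ^ 2)) * ∑ e, ∫ x in (0 : ℝ)..G.len e,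
      (starRingEnd ℂ) ((solution l t).u e x) * (solution k s).u e x =
    ∑ p, ((starRingEnd ℂ) ((solution l t).trace p) * (solution k s).normalDeriv p
      - (starRingEnd ℂ) ((solution l t).normalDeriv p) * (solution k s).trace p) := by
  rw [Finset.mul_sum, Fintype.sum_prod_type]
  refine Finset.sum_congr rfl fun e _ => ?_
  have hcu : ∀ k (s : G.E → ℂ × ℂ), Continuous ((solution k s).u e) := fun k s =>
    continuous_iff_continuousAt.2 fun x => (hasDerivAt_solution_u k s e x).continuousAt
  have hs := hcu k s
  have ht := hcu l t
  -- With `v` the solution for `l`, the primitive is the Wronskian `conj v' u - conj v u'`; the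
  -- products of first derivatives cancel when it is differentiated.
  rw [← intervalIntegral.integral_const_mul, intervalIntegral.integral_eq_sub_of_hasDerivAt
    (f := fun x => (starRingEnd ℂ) ((solution l t).du e x) * (solution k s).u e x
      - (starRingEnd ℂ) ((solution l t).u e x) * (solution k s).du e x)]
  · simp only [Fintype.sum_bool, W22.trace, W22.normalDeriv, if_true, Bool.false_eq_true, if_false,
      map_neg]
    ring
  · intro x _
    refine (((hasDerivAt_solution_du l t e x).star.mul (hasDerivAt_solution_u k s e x)).sub
      ((hasDerivAt_solution_u l t e x).star.mul (hasDerivAt_solution_du k s e x))).congr_deriv ?_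
    simp only [starRingEnd_apply, star_mul', star_neg, star_pow]
    ring
  · exact Continuous.intervalIntegrable
      (continuous_const.mul ((Complex.continuous_conj.comp ht).mul hs)) _ _

open Filter Topology

variable {B : Type v} {c : B ↪ G.V}

/-- `w` satisfies the conditions at all vertices required of the solutions defining the
`M`-function, with the values `a` and the sums `b` of oriented derivatives at the contact
vertices. -/
def W22.HasContactData (w : W22 G) (c : B ↪ G.V) (a b : B → ℂ) : Prop :=
  w.ContinuousAtVertices ∧ (∀ m, m ∉ range c → w.flux m = 0) ∧
    (∀ i, w.HasValueAt (c i) (a i)) ∧ ∀ i, w.flux (c i) = b i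

lemma mem_contactData_iff {k : ℂ} {a b : B → ℂ} :
    (a, b) ∈ G.contactData c (k ^ 2) ↔ ∃ s, (solution k s).HasContactData c a b := by
  constructor
  · rintro ⟨w, h1, h2, h3, h4, h5⟩
    refine ⟨fun e => (w.u e 0, w.du e 0), ?_, ?_, ?_, ?_⟩
    · simpa only [W22.ContinuousAtVertices, h1.trace_eq] using h2
    · simpa only [h1.flux_eq] using h3
    · simpa only [W22.HasValueAt, h1.trace_eq] using h4
    · simpa only [h1.flux_eq] using h5
  · rintro ⟨s, h⟩
    exact ⟨_, isSolution_solution k s, h⟩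

lemma W22.HasContactData.smul {w : W22 G} {a b : B → ℂ} (h : w.HasContactData c a b) (r : ℂ) :
    (r • w).HasContactData c (r • a) (r • b) :=
  ⟨h.1.smul r, fun m hm => by simp [h.2.1 m hm], fun i p hp => by simp [h.2.2.1 i p hp],
    fun i => by simp [h.2.2.2 i]⟩

/-- All the conditions are equations between functions jointly continuous in `k`, the initial data
and the boundary data. -/
lemma isClosed_hasContactData : IsClosed {q : (ℂ × (G.E → ℂ × ℂ)) × (B → ℂ) × (B → ℂ) |
    (solution q.1.1 q.1.2).HasContactData c q.2.1 q.2.2} := by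
  have ht : ∀ p, Continuous fun q : (ℂ × (G.E → ℂ × ℂ)) × (B → ℂ) × (B → ℂ) =>
      (solution q.1.1 q.1.2).trace p := fun p =>
    (continuous_solution_trace p).comp continuous_fst
  have hf : ∀ m, Continuous fun q : (ℂ × (G.E → ℂ × ℂ)) × (B → ℂ) × (B → ℂ) =>
      (solution q.1.1 q.1.2).flux m := fun m =>
    (continuous_solution_flux m).comp continuous_fst
  simp only [W22.HasContactData, W22.ContinuousAtVertices, W22.HasValueAt, ofPred_and, ofPred_forall]
  refine IsClosed.inter ?_ (IsClosed.inter ?_ (IsClosed.inter ?_ ?_))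
  · exact isClosed_iInter fun p => isClosed_iInter fun q => isClosed_iInter fun _ =>
      isClosed_eq (ht p) (ht q)
  · exact isClosed_iInter fun m => isClosed_iInter fun _ => isClosed_eq (hf m) continuous_const
  · exact isClosed_iInter fun i => isClosed_iInter fun p => isClosed_iInter fun _ =>
      isClosed_eq (ht p) (by fun_prop)
  · exact isClosed_iInter fun i => isClosed_eq (hf _) (by fun_prop)

/-- The inner product of two solutions in `L₂`. -/
noncomputable def solutionInner (l : ℂ) (t : G.E → ℂ × ℂ) (k : ℂ) (s : G.E → ℂ × ℂ) : ℂ :=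
  ∑ e, ∫ x in (0 : ℝ)..G.len e, (starRingEnd ℂ) ((solution l t).u e x) * (solution k s).u e x

lemma continuous_solutionInner (l : ℂ) (t : G.E → ℂ × ℂ) :
    Continuous fun q : ℂ × (G.E → ℂ × ℂ) => solutionInner l t q.1 q.2 := by
  refine continuous_finsetSum _ fun e _ =>
    intervalIntegral.continuous_parametric_intervalIntegral_of_continuous' ?_ _ _
  have h1 : Continuous fun q : (ℂ × (G.E → ℂ × ℂ)) × ℝ => (solution l t).u e q.2 :=
    (continuous_solution_u e).comp
      (f := fun q : (ℂ × (G.E → ℂ × ℂ)) × ℝ => ((l, t), q.2)) (by fun_prop)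
  exact (Complex.continuous_conj.comp h1).mul (continuous_solution_u e)

lemma solutionInner_self (k : ℂ) (s : G.E → ℂ × ℂ) : solutionInner k s k s =
    ((∑ e, ∫ x in (0 : ℝ)..G.len e, Complex.normSq ((solution k s).u e x) : ℝ) : ℂ) := by
  rw [solutionInner, Complex.ofReal_sum]
  refine Finset.sum_congr rfl fun e _ => ?_
  rw [← intervalIntegral.integral_ofReal]
  simp only [Complex.normSq_eq_conj_mul_self]

lemma solution_injective {k : ℂ} {s : G.E → ℂ × ℂ}
    (h : ∀ e, ∀ x ∈ Icc 0 (G.len e), (solution k s).u e x = 0) : s = 0 := by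
  funext e
  have h0 : (0 : ℝ) ∈ Icc 0 (G.len e) := ⟨le_rfl, (G.len_pos e).le⟩
  refine Prod.ext ?_ ?_
  · rw [← solution_u_zero k s e, h e 0 h0]
    rfl
  · rw [← solution_du_zero k s e, (solution k s).du_eq_zero e (h e) 0 h0]
    rfl

lemma eq_zero_of_solutionInner_self {k : ℂ} {s : G.E → ℂ × ℂ} (h : solutionInner k s k s = 0) :
    s = 0 := by
  rw [solutionInner_self, Complex.ofReal_eq_zero] at h
  have hnn : ∀ e ∈ (Finset.univ : Finset G.E),
      0 ≤ ∫ x in (0 : ℝ)..G.len e, Complex.normSq ((solution k s).u e x) := fun e _ =>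
    intervalIntegral.integral_nonneg (G.len_pos e).le fun _ _ => Complex.normSq_nonneg _
  refine solution_injective (k := k) fun e => ?_
  have he := (Finset.sum_eq_zero_iff_of_nonneg hnn).1 h e (Finset.mem_univ _)
  have hcont : ContinuousOn (fun x => Complex.normSq ((solution k s).u e x)) (Icc 0 (G.len e)) :=
    Complex.continuous_normSq.comp_continuousOn ((solution k s).continuousOn_u e)
  rw [intervalIntegral.integral_eq_zero_iff_of_le_of_nonneg_ae (G.len_pos e).le
    (Eventually.of_forall fun _ => Complex.normSq_nonneg _)
    (ContinuousOn.intervalIntegrable (by rwa [uIcc_of_le (G.len_pos e).le]))] at he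
  apply W22.eqOn_zero (G.len_pos e) ((solution k s).continuousOn_u e)
  rw [← restrict_Ioc_eq_restrict_Icc]
  filter_upwards [he] with x hx
  exact Complex.normSq_eq_zero.1 hx

lemma W22.sum_mul_normalDeriv_of_flux_eq_zero [Fintype B] {w : W22 G}
    (hw : ∀ m, m ∉ range c → w.flux m = 0) (φ : G.V → ℂ) :
    ∑ p, φ (G.vtx p) * w.normalDeriv p = ∑ i, φ (c i) * w.flux (c i) := by
  classical
  have := Fintype.ofFinite G.V
  rw [w.sum_mul_normalDeriv, ← Finset.sum_subset (Finset.subset_univ (Finset.univ.map c)),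
    Finset.sum_map]
  intro m _ hm
  rw [hw m (by simpa using hm), mul_zero]

/-- The trace of `z` is a function of the vertex by continuity. Grouping the end points by vertices
leaves only the contact vertices, since the flux of `w` vanishes elsewhere. -/
lemma W22.HasContactData.sum_trace_mul [Fintype B] {w z : W22 G} {a b a' b' : B → ℂ}
    (hw : w.HasContactData c a b) (hz : z.HasContactData c a' b') :
    ∑ p, (starRingEnd ℂ) (z.trace p) * w.normalDeriv p = ∑ i, (starRingEnd ℂ) (a' i) * b i := by
  choose r hr using G.vtx_surj
  have h1 : ∀ p, z.trace p = z.trace (r (G.vtx p)) := fun p => hz.1 _ _ (hr _).symm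
  rw [Finset.sum_congr rfl fun p _ => by rw [h1 p],
    W22.sum_mul_normalDeriv_of_flux_eq_zero hw.2.1 fun m => (starRingEnd ℂ) (z.trace (r m))]
  refine Finset.sum_congr rfl fun i _ => ?_
  rw [hz.2.2.1 i _ (hr _), hw.2.2.2 i]

lemma green_contactData [Fintype B] {k l : ℂ} {s t : G.E → ℂ × ℂ} {a b a' b' : B → ℂ}
    (hs : (solution k s).HasContactData c a b) (ht : (solution l t).HasContactData c a' b') :
    (k ^ 2 - (starRingEnd ℂ) (l ^ 2)) * solutionInner l t k s =
      ∑ i, ((starRingEnd ℂ) (a' i) * b i - (starRingEnd ℂ) (b' i) * a i) := by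
  rw [solutionInner, green, Finset.sum_sub_distrib, Finset.sum_sub_distrib, hs.sum_trace_mul ht]
  congr 1
  have h := congrArg (starRingEnd ℂ) (ht.sum_trace_mul hs)
  simpa only [map_sum, map_mul, Complex.conj_conj, mul_comm] using h

/-- Normalise and use compactness of the unit sphere; the factors `r n = 1 / ‖s (φ n)‖` tend to
zero. -/
lemma exists_subseq_of_not_bounded {E : Type*} [NormedAddCommGroup E] [NormedSpace ℂ E]
    [ProperSpace E] {s : ℕ → E} (h : ∀ C, ∀ᶠ n in atTop, C < ‖s n‖) :
    ∃ t : E, ‖t‖ = 1 ∧ ∃ φ : ℕ → ℕ, StrictMono φ ∧ ∃ r : ℕ → ℂ,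
      Tendsto r atTop (𝓝 0) ∧ Tendsto (fun n => r n • s (φ n)) atTop (𝓝 t) := by
  have hat : Tendsto (fun n => ‖s n‖) atTop atTop :=
    tendsto_atTop.2 fun C => (h C).mono fun _ => le_of_lt
  have h1 : ∀ᶠ n in atTop, (((‖s n‖⁻¹ : ℝ) : ℂ) • s n) ∈ Metric.sphere (0 : E) 1 := by
    filter_upwards [h 0] with n hn
    rw [mem_sphere_zero_iff_norm, norm_smul, Complex.norm_real, norm_inv, norm_norm,
      inv_mul_cancel₀ hn.ne']
  obtain ⟨t, ht, φ, hφ, hlim⟩ := tendsto_subseq_of_frequently_bounded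
    (Metric.isBounded_sphere (x := (0 : E)) (r := 1)) h1.frequently
  rw [Metric.isClosed_sphere.closure_eq, mem_sphere_zero_iff_norm] at ht
  refine ⟨t, ht, φ, hφ, fun n => ((‖s (φ n)‖⁻¹ : ℝ) : ℂ), ?_, hlim⟩
  have := (tendsto_inv_atTop_zero.comp hat).comp hφ.tendsto_atTop
  exact (Complex.continuous_ofReal.tendsto' 0 0 Complex.ofReal_zero).comp this

/-- Limits at real points of boundary data of solutions at nonreal points are again boundary data
of solutions. -/
lemma mem_contactData_of_tendsto {κ : ℕ → ℂ} {k : ℂ} {α β : ℕ → B → ℂ} {a b : B → ℂ}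
    (hκ : Tendsto κ atTop (𝓝 k)) (hk : (k ^ 2).im = 0) (him : ∀ n, (κ n ^ 2).im ≠ 0)
    (hα : Tendsto α atTop (𝓝 a)) (hβ : Tendsto β atTop (𝓝 b))
    (h : ∀ n, (α n, β n) ∈ G.contactData c (κ n ^ 2)) : (a, b) ∈ G.contactData c (k ^ 2) := by
  have : Finite B := Finite.of_injective c c.injective
  have := Fintype.ofFinite B
  choose s hs using fun n => mem_contactData_iff.1 (h n)
  -- If the initial data are bounded along a subsequence, compactness gives a limit solution.
  by_cases hb : ∃ C, ∃ᶠ n in atTop, s n ∈ Metric.closedBall 0 C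
  · obtain ⟨C, hC⟩ := hb
    obtain ⟨t, -, φ, hφ, hlim⟩ := tendsto_subseq_of_frequently_bounded Metric.isBounded_closedBall hC
    have hφ := hφ.tendsto_atTop
    refine mem_contactData_iff.2 ⟨t, ?_⟩
    exact isClosed_hasContactData.mem_of_tendsto
      (((hκ.comp hφ).prodMk_nhds hlim).prodMk_nhds
        ((hα.comp hφ).prodMk_nhds (hβ.comp hφ))) (Eventually.of_forall fun n => hs (φ n))
  · exfalso
    simp only [not_exists, not_frequently, mem_closedBall_zero_iff, not_le] at hb
    -- Otherwise normalise. As `α` and `β` converge, the scaled boundary data tend to zero, and the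
    -- limit `t` is a unit vector with zero boundary data at `k`.
    obtain ⟨t, ht, φ, hφ, r, hr, hlim⟩ := exists_subseq_of_not_bounded hb
    have hφ := hφ.tendsto_atTop
    have hs' : ∀ n, (solution (κ (φ n)) (r n • s (φ n))).HasContactData c
        (r n • α (φ n)) (r n • β (φ n)) := fun n => by
      rw [solution_smul]
      exact (hs (φ n)).smul _
    have ht0 : (solution k t).HasContactData c 0 0 := by
      have ha := hr.smul (hα.comp hφ)
      have hb := hr.smul (hβ.comp hφ)
      rw [zero_smul] at ha hb
      exact isClosed_hasContactData.mem_of_tendsto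
        (((hκ.comp hφ).prodMk_nhds hlim).prodMk_nhds (ha.prodMk_nhds hb))
        (Eventually.of_forall hs')
    -- The boundary terms vanish with the data of `t`, and the factor `κ² - conj (k²)` is nonzero
    -- because `k²` is real and `κ²` is not. In the limit `t` is orthogonal to itself.
    have h0 : ∀ n, solutionInner k t (κ (φ n)) (r n • s (φ n)) = 0 := fun n => by
      have hg := green_contactData (hs' n) ht0
      simp only [Pi.zero_apply, map_zero, zero_mul, sub_zero, Finset.sum_const_zero] at hg
      refine (mul_eq_zero.1 hg).resolve_left fun h0 => him (φ n) ?_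
      rw [sub_eq_zero.1 h0, Complex.conj_im, hk, neg_zero]
    have hlim0 := ((continuous_solutionInner k t).tendsto (k, t)).comp
      ((hκ.comp hφ).prodMk_nhds hlim)
    have := tendsto_nhds_unique hlim0
      ((tendsto_const_nhds (x := (0 : ℂ))).congr fun n => (h0 n).symm)
    rw [eq_zero_of_solutionInner_self this, norm_zero] at ht
    exact zero_ne_one ht

/-! ### Dissipative boundary conditions and the passage to real points -/

lemma im_sum_nonpos [Fintype B] {k : ℂ} (hk : (k ^ 2).im ≤ 0) {a b : B → ℂ}
    (h : (a, b) ∈ G.contactData c (k ^ 2)) : (∑ i, (starRingEnd ℂ) (a i) * b i).im ≤ 0 := by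
  obtain ⟨s, hs⟩ := mem_contactData_iff.1 h
  have hg := congrArg Complex.im (green_contactData hs hs)
  rw [solutionInner_self, Complex.im_mul_ofReal, Finset.sum_sub_distrib] at hg
  have hnn : 0 ≤ ∑ e, ∫ x in (0 : ℝ)..G.len e, Complex.normSq ((solution k s).u e x) :=
    Finset.sum_nonneg fun e _ =>
      intervalIntegral.integral_nonneg (G.len_pos e).le fun _ _ => Complex.normSq_nonneg _
  have hc : ∑ i, (starRingEnd ℂ) (b i) * a i
      = (starRingEnd ℂ) (∑ i, (starRingEnd ℂ) (a i) * b i) := by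
    simp only [map_sum, map_mul, Complex.conj_conj, mul_comm]
  rw [hc, Complex.sub_im, Complex.sub_im, Complex.conj_im, Complex.conj_im] at hg
  nlinarith [mul_nonneg (neg_nonneg.2 hk) hnn]

/-- Solutions with the dissipative boundary data `g = b - i a` have bounded values. -/
lemma sum_norm_sq_le [Fintype B] {k : ℂ} (hk : (k ^ 2).im ≤ 0) {a g : B → ℂ}
    (h : (a, Complex.I • a + g) ∈ G.contactData c (k ^ 2)) :
    ∑ i, ‖a i‖ ^ 2 ≤ ∑ i, ‖g i‖ ^ 2 := by
  have h1 := im_sum_nonpos hk h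
  rw [Complex.im_sum] at h1
  have h2 : ∀ i, ‖a i‖ ^ 2 - ‖g i‖ ^ 2
      ≤ 2 * ((starRingEnd ℂ) (a i) * (Complex.I • a + g) i).im := fun i => by
    simp only [← Complex.normSq_eq_norm_sq, Complex.normSq_apply, Pi.add_apply, Pi.smul_apply,
      smul_eq_mul, Complex.mul_im, Complex.conj_re, Complex.conj_im, Complex.add_im, Complex.add_re,
      Complex.mul_re, Complex.I_re, Complex.I_im]
    -- The difference of the two sides is `|a - i g|²`.
    nlinarith [sq_nonneg ((a i).re + (g i).im), sq_nonneg ((a i).im - (g i).re)]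
  have h3 := Finset.sum_le_sum fun i (_ : i ∈ Finset.univ) => h2 i
  rw [Finset.sum_sub_distrib, ← Finset.mul_sum] at h3
  linarith

/-- The operator `M - i` is injective by the bound with `g = 0`, hence surjective in finite
dimension. -/
lemma exists_dissipative_data {k : ℂ} (hk : (k ^ 2).im < 0) (g : B → ℂ) :
    ∃ a, (a, Complex.I • a + g) ∈ G.contactData c (k ^ 2) := by
  have : Finite B := Finite.of_injective c c.injective
  have := Fintype.ofFinite B
  let T : (B → ℂ) →ₗ[ℂ] (B → ℂ) := G.mFunction c (k ^ 2) hk.ne - Complex.I • LinearMap.id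
  have hT : ∀ a g, T a = g ↔ (a, Complex.I • a + g) ∈ G.contactData c (k ^ 2) := fun a g => by
    rw [← mFunction_eq_iff G c hk.ne, add_comm, ← sub_eq_iff_eq_add]
    rfl
  have hinj : Function.Injective T := by
    rw [← LinearMap.ker_eq_bot, LinearMap.ker_eq_bot']
    intro a ha
    have h := sum_norm_sq_le hk.le ((hT a 0).1 ha)
    simp only [Pi.zero_apply, norm_zero, ne_eq, OfNat.ofNat_ne_zero, not_false_eq_true, zero_pow,
      Finset.sum_const_zero] at h
    funext i
    have h0 := (Finset.sum_eq_zero_iff_of_nonneg fun i _ => sq_nonneg ‖a i‖).1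
      (h.antisymm (Finset.sum_nonneg fun i _ => sq_nonneg ‖a i‖)) i (Finset.mem_univ i)
    simpa using h0
  obtain ⟨a, ha⟩ := LinearMap.injective_iff_surjective.1 hinj g
  exact ⟨a, (hT a g).1 ha⟩

/-- Moving from the square root diagonally, by `1 - i` or `-1 + i` according to the sign of `μ`,
makes `Im κ²` strictly negative even when `μ = 0`. -/
lemma exists_seq_sq {μ : ℂ} (hμ : μ.im = 0) : ∃ (k : ℂ) (κ : ℕ → ℂ), k ^ 2 = μ ∧
    Tendsto κ atTop (𝓝 k) ∧ ∀ n, (κ n ^ 2).im < 0 := by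
  have hlim : ∀ k z : ℂ, Tendsto (fun n : ℕ => k + ((1 / ((n : ℝ) + 1) : ℝ) : ℂ) * z) atTop
      (𝓝 k) := fun k z => by
    have h := (Complex.continuous_ofReal.tendsto 0).comp tendsto_one_div_add_atTop_nhds_zero_nat
    simpa using (h.mul_const z).const_add k
  have hpos : ∀ n : ℕ, 0 < 1 / ((n : ℝ) + 1) := fun n => by positivity
  rcases le_total 0 μ.re with h | h
  · refine ⟨(√μ.re : ℝ), _, ?_, hlim _ (1 - Complex.I), fun n => ?_⟩
    · rw [← Complex.ofReal_pow, Real.sq_sqrt h]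
      exact Complex.ext rfl hμ.symm
    · have := hpos n
      set r := 1 / ((n : ℝ) + 1)
      simp [sq]
      nlinarith [Real.sqrt_nonneg μ.re, mul_nonneg (Real.sqrt_nonneg μ.re) this.le, mul_pos this this]
  · refine ⟨(√(-μ.re) : ℝ) * Complex.I, _, ?_, hlim _ (-1 + Complex.I), fun n => ?_⟩
    · rw [mul_pow, ← Complex.ofReal_pow, Real.sq_sqrt (neg_nonneg.2 h), Complex.I_sq]
      exact Complex.ext (by simp) (by simp [hμ])
    · have := hpos n
      set r := 1 / ((n : ℝ) + 1)
      simp [sq]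
      nlinarith [Real.sqrt_nonneg (-μ.re), mul_nonneg (Real.sqrt_nonneg (-μ.re)) this.le,
        mul_pos this this]

lemma SteklovEquivalent.contactData_eq_of_nonreal {G₁ G₂ : MetricGraph.{u}} {c₁ : B ↪ G₁.V}
    {c₂ : B ↪ G₂.V} (h : SteklovEquivalent G₁ c₁ G₂ c₂) {μ : ℂ} (hμ : μ.im ≠ 0) :
    G₁.contactData c₁ μ = G₂.contactData c₂ μ := by
  ext ⟨a, b⟩
  rw [← mFunction_eq_iff G₁ c₁ hμ, ← mFunction_eq_iff G₂ c₂ hμ, h μ hμ]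

/-- The `M`-functions cannot be compared at a real point directly. The datum `(a, b)` is recovered
there as the limit of solutions of the dissipative problem with the fixed right-hand side `b - i a`.
-/
lemma SteklovEquivalent.contactData_le_of_real {G₁ G₂ : MetricGraph.{u}} {c₁ : B ↪ G₁.V}
    {c₂ : B ↪ G₂.V} (h : SteklovEquivalent G₁ c₁ G₂ c₂) {μ : ℂ} (hμ : μ.im = 0) :
    G₁.contactData c₁ μ ≤ G₂.contactData c₂ μ := by
  rintro ⟨a, b⟩ hab
  have : Finite B := Finite.of_injective c₁ c₁.injective
  have := Fintype.ofFinite B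
  obtain ⟨k, κ, rfl, hκ, him⟩ := exists_seq_sq hμ
  set g := b - Complex.I • a with hg
  choose α hα using fun n => exists_dissipative_data (c := c₁) (him n) g
  have hbd : ∀ n, α n ∈ Metric.closedBall 0 √(∑ i, ‖g i‖ ^ 2) := fun n => by
    rw [mem_closedBall_zero_iff, pi_norm_le_iff_of_nonneg (Real.sqrt_nonneg _)]
    intro i
    refine Real.le_sqrt_of_sq_le (le_trans ?_ (sum_norm_sq_le (him n).le (hα n)))
    exact Finset.single_le_sum (f := fun i => ‖α n i‖ ^ 2) (fun i _ => sq_nonneg _)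
      (Finset.mem_univ i)
  obtain ⟨a', -, φ, hφ, hlim⟩ := tendsto_subseq_of_bounded Metric.isBounded_closedBall hbd
  have hφ := hφ.tendsto_atTop
  have hlim' : Tendsto (fun n => Complex.I • α (φ n) + g) atTop (𝓝 (Complex.I • a' + g)) :=
    (hlim.const_smul Complex.I).add_const g
  have h1 := mem_contactData_of_tendsto (hκ.comp hφ) hμ (fun n => (him _).ne) hlim hlim'
    fun n => hα (φ n)
  have h2 := mem_contactData_of_tendsto (hκ.comp hφ) hμ (fun n => (him _).ne) hlim hlim'
    fun n => h.contactData_eq_of_nonreal (him (φ n)).ne ▸ hα (φ n)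
  -- Both data solve the dissipative problem with the same `g`. The bound also holds at real points,
  -- so their difference vanishes.
  have h3 : (a' - a, Complex.I • (a' - a) + 0) ∈ G₁.contactData c₁ (k ^ 2) := by
    have := Submodule.sub_mem _ h1 hab
    rw [Prod.mk_sub_mk] at this
    convert this using 2
    rw [hg, smul_sub]
    abel
  have h4 := sum_norm_sq_le hμ.le h3
  have h5 : a' = a := by
    simp only [Pi.zero_apply, norm_zero, ne_eq, OfNat.ofNat_ne_zero, not_false_eq_true, zero_pow,
      Finset.sum_const_zero] at h4
    funext i
    have h0 := (Finset.sum_eq_zero_iff_of_nonneg fun i _ => sq_nonneg ‖(a' - a) i‖).1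
      (h4.antisymm (Finset.sum_nonneg fun i _ => sq_nonneg ‖(a' - a) i‖)) i (Finset.mem_univ i)
    simpa [sub_eq_zero] using h0
  rw [h5, hg, add_sub_cancel] at h2
  exact h2

lemma SteklovEquivalent.symm {G₁ G₂ : MetricGraph.{u}} {c₁ : B ↪ G₁.V}
    {c₂ : B ↪ G₂.V} (h : SteklovEquivalent G₁ c₁ G₂ c₂) : SteklovEquivalent G₂ c₂ G₁ c₁ :=
  fun μ hμ => (h μ hμ).symm

/-- Steklov-equivalent graphs have the same boundary data of solutions at every point. -/
lemma SteklovEquivalent.contactData_eq {G₁ G₂ : MetricGraph.{u}} {c₁ : B ↪ G₁.V}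
    {c₂ : B ↪ G₂.V} (h : SteklovEquivalent G₁ c₁ G₂ c₂) (μ : ℂ) :
    G₁.contactData c₁ μ = G₂.contactData c₂ μ := by
  by_cases hμ : μ.im = 0
  · exact (h.contactData_le_of_real hμ).antisymm (h.symm.contactData_le_of_real hμ)
  · exact h.contactData_eq_of_nonreal hμ

end MetricGraph

/-! ### Linear algebra of the dimension count -/

/-- Rank-nullity for `f` restricted to `Y ⊓ f⁻¹ H`: its kernel does not see `H`, because `f⁻¹ H`
contains the kernel of `f`. -/
lemma Submodule.finrank_inf_comap {F V W : Type*} [Field F] [AddCommGroup V] [Module F V]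
    [FiniteDimensional F V] [AddCommGroup W] [Module F W] (f : V →ₗ[F] W) (Y : Submodule F V)
    (H : Submodule F W) :
    Module.finrank F ↥(Y ⊓ H.comap f)
      = Module.finrank F ↥(Y ⊓ LinearMap.ker f) + Module.finrank F ↥(Y.map f ⊓ H) := by
  have h1 : (Y ⊓ H.comap f).map f = Y.map f ⊓ H := by
    ext z
    constructor
    · rintro ⟨y, ⟨hy, hH⟩, rfl⟩
      exact ⟨⟨y, hy, rfl⟩, hH⟩
    · rintro ⟨⟨y, hy, rfl⟩, hH⟩
      exact ⟨y, ⟨hy, hH⟩, rfl⟩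
  have h2 : Y ⊓ H.comap f ⊓ LinearMap.ker f = Y ⊓ LinearMap.ker f := by
    rw [inf_assoc, inf_eq_right.2 (LinearMap.ker_le_comap f)]
  rw [← ((f.domRestrict (Y ⊓ H.comap f))).finrank_range_add_finrank_ker,
    LinearMap.range_domRestrict, LinearMap.ker_domRestrict, ← Submodule.finrank_map_subtype_eq,
    Submodule.map_comap_subtype, h1, h2, add_comm]

/-- The preceding count for `id × f`, whose kernel is that of `f`. The additional factor will hold
the initial data on `K`. -/
lemma Submodule.finrank_prod_inf_comap_prodMap {F V V' W : Type*} [Field F] [AddCommGroup V]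
    [Module F V] [FiniteDimensional F V] [AddCommGroup V'] [Module F V'] [FiniteDimensional F V']
    [AddCommGroup W] [Module F W] (f : V →ₗ[F] W) (Y : Submodule F V) (H : Submodule F (V' × W)) :
    Module.finrank F ↥(Submodule.prod ⊤ Y ⊓ H.comap (LinearMap.prodMap LinearMap.id f))
      = Module.finrank F ↥(Y ⊓ LinearMap.ker f)
        + Module.finrank F ↥(Submodule.prod ⊤ (Y.map f) ⊓ H) := by
  have h1 : (Submodule.prod ⊤ Y).map (LinearMap.prodMap LinearMap.id f)
      = Submodule.prod (⊤ : Submodule F V') (Y.map f) := by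
    ext ⟨x, z⟩
    constructor
    · rintro ⟨⟨x', y⟩, ⟨-, hy⟩, h⟩
      exact ⟨trivial, y, hy, congrArg Prod.snd h⟩
    · rintro ⟨-, y, hy, h⟩
      exact ⟨(x, y), ⟨trivial, hy⟩, Prod.ext rfl h⟩
  have h2 : Submodule.prod ⊤ Y ⊓ LinearMap.ker (LinearMap.prodMap LinearMap.id f)
      = (Y ⊓ LinearMap.ker f).map (LinearMap.inr F V' V) := by
    ext ⟨x, y⟩
    constructor
    · rintro ⟨⟨-, hy⟩, h⟩
      exact ⟨y, ⟨hy, congrArg Prod.snd h⟩, Prod.ext (congrArg Prod.fst h).symm rfl⟩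
    · rintro ⟨y', ⟨hy, h⟩, h'⟩
      obtain ⟨rfl, rfl⟩ := Prod.ext_iff.1 h'
      exact ⟨⟨trivial, hy⟩, Prod.ext rfl h⟩
  rw [Submodule.finrank_inf_comap, h1, h2,
    (Submodule.equivMapOfInjective (LinearMap.inr F V' V) LinearMap.inr_injective _).finrank_eq]

/-! ### Eigenspaces as finite-dimensional spaces of initial data -/

namespace MetricGraph

variable {G : MetricGraph.{u}} {B : Type v}

/-- The initial data of the solutions of `-w'' = k² w` satisfying the standard conditions. -/
noncomputable def standardData (G : MetricGraph.{u}) (k : ℂ) : Submodule ℂ (G.E → ℂ × ℂ) where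
  carrier := {s | (solution k s).Standard}
  zero_mem' := by
    simp only [mem_ofPred_eq, solution_zero]
    exact ⟨fun p q _ => by simp, fun m => by simp⟩
  add_mem' := by
    intro s t hs ht
    simp only [mem_ofPred_eq, solution_add] at hs ht ⊢
    exact ⟨hs.1.add ht.1, fun m => by simp [hs.2, ht.2]⟩
  smul_mem' := by
    intro r s hs
    simp only [mem_ofPred_eq, solution_smul] at hs ⊢
    exact ⟨hs.1.smul r, fun m => by simp [hs.2]⟩

lemma W22.memLp_u (w : W22 G) (e : G.E) : MemLp (w.u e) 2 (G.edgeMeasure e) := by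
  obtain ⟨C, hC⟩ := (isCompact_Icc (a := (0 : ℝ)) (b := G.len e)).exists_bound_of_continuousOn
    (w.continuousOn_u e)
  exact MemLp.of_bound ((w.continuousOn_u e).aestronglyMeasurable measurableSet_Icc) C
    ((ae_restrict_iff' measurableSet_Icc).2 (Filter.Eventually.of_forall hC))

/-- The solution with given initial data as an element of `L₂`. -/
noncomputable def solutionL2 (G : MetricGraph.{u}) (k : ℂ) : (G.E → ℂ × ℂ) →ₗ[ℂ] L2 G where
  toFun s := WithLp.toLp 2 fun e => ((solution k s).memLp_u e).toLp _
  map_add' s t := by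
    ext1 e
    rw [PiLp.add_apply]
    exact (MemLp.toLp_congr (W22.memLp_u _ e) (((solution k s).memLp_u e).add ((solution k t).memLp_u e))
      (by rw [solution_add]; rfl)).trans (MemLp.toLp_add ((solution k s).memLp_u e) ((solution k t).memLp_u e))
  map_smul' r s := by
    ext1 e
    rw [PiLp.smul_apply]
    exact (MemLp.toLp_congr (W22.memLp_u _ e) (((solution k s).memLp_u e).const_smul r)
      (by rw [solution_smul]; rfl)).trans (MemLp.toLp_const_smul r ((solution k s).memLp_u e))

lemma coeFn_solutionL2 (k : ℂ) (s : G.E → ℂ × ℂ) (e : G.E) :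
    G.solutionL2 k s e =ᵐ[G.edgeMeasure e] (solution k s).u e :=
  MemLp.coeFn_toLp ((solution k s).memLp_u e)

lemma solutionL2_injective (k : ℂ) : Function.Injective (G.solutionL2 k) := by
  rw [← LinearMap.ker_eq_bot, LinearMap.ker_eq_bot']
  intro s hs
  refine solution_injective (k := k) fun e =>
    W22.eqOn_zero (G.len_pos e) ((solution k s).continuousOn_u e) ?_
  filter_upwards [coeFn_solutionL2 k s e, Lp.coeFn_zero ℂ 2 (G.edgeMeasure e)] with x h1 h2
  rw [← h1, hs]
  exact h2

lemma eigenspace_eq_map (G : MetricGraph.{u}) (k : ℂ) :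
    G.eigenspace (k ^ 2) = (G.standardData k).map (G.solutionL2 k) := by
  ext f
  rw [mem_eigenspace]
  constructor
  · rintro ⟨w, hw, h⟩
    have hsol : w.IsSolution (k ^ 2) := fun e => by
      filter_upwards [(h e).1, (h e).2, Lp.coeFn_smul (k ^ 2) (f e)] with x h1 h2 h3
      rw [← h2, ← h1]
      exact h3
    refine ⟨fun e => (w.u e 0, w.du e 0), ⟨?_, ?_⟩, ?_⟩
    · simpa only [W22.ContinuousAtVertices, hsol.trace_eq] using hw.1
    · simpa only [hsol.flux_eq] using hw.2
    · ext1 e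
      refine Lp.ext ?_
      have hmem : ∀ᵐ x ∂G.edgeMeasure e, x ∈ Icc 0 (G.len e) := ae_restrict_mem measurableSet_Icc
      filter_upwards [(h e).1, coeFn_solutionL2 k (fun e => (w.u e 0, w.du e 0)) e, hmem]
        with x h1 h2 hx
      rw [h2, h1, (hsol.eq_solution e hx).1]
  · rintro ⟨s, hs, rfl⟩
    refine ⟨solution k s, hs, fun e => ⟨coeFn_solutionL2 k s e, ?_⟩⟩
    filter_upwards [Lp.coeFn_smul (k ^ 2) (G.solutionL2 k s e), coeFn_solutionL2 k s e,
      isSolution_solution k s e] with x h1 h2 h3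
    rw [h3, ← h2]
    exact h1

/-- Multiplicities are natural numbers, so that terms can later be cancelled. -/
lemma rank_eigenspace (G : MetricGraph.{u}) (k : ℂ) :
    Module.rank ℂ (G.eigenspace (k ^ 2)) = (Module.finrank ℂ (G.standardData k) : Cardinal.{u}) := by
  have e := Submodule.equivMapOfInjective (G.solutionL2 k) (solutionL2_injective k)
    (G.standardData k)
  rw [eigenspace_eq_map, ← e.rank_eq, Module.finrank_eq_rank]

/-! ### Splitting solutions into an invisible part and boundary data -/

/-- The initial data of the solutions of `-w'' = k² w` satisfying the conditions at all vertices
required for the definition of the `M`-function. -/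
noncomputable def freeData (G : MetricGraph.{u}) (c : B ↪ G.V) (k : ℂ) :
    Submodule ℂ (G.E → ℂ × ℂ) where
  carrier := {s | (solution k s).ContinuousAtVertices ∧
    ∀ m, m ∉ range c → (solution k s).flux m = 0}
  zero_mem' := by
    simp only [mem_ofPred_eq, solution_zero]
    exact ⟨fun p q _ => by simp, fun m _ => by simp⟩
  add_mem' := by
    intro s t hs ht
    simp only [mem_ofPred_eq, solution_add] at hs ht ⊢
    exact ⟨hs.1.add ht.1, fun m hm => by simp [hs.2 m hm, ht.2 m hm]⟩
  smul_mem' := by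
    intro r s hs
    simp only [mem_ofPred_eq, solution_smul] at hs ⊢
    exact ⟨hs.1.smul r, fun m hm => by simp [hs.2 m hm]⟩

/-- The values and the sums of oriented derivatives at the contact vertices of the solution with
given initial data. -/
noncomputable def boundaryMap (G : MetricGraph.{u}) (c : B ↪ G.V) (k : ℂ) :
    (G.E → ℂ × ℂ) →ₗ[ℂ] (B → ℂ) × (B → ℂ) where
  -- The end point chosen at each contact vertex is immaterial on `freeData`, where solutions are
  -- continuous at the vertices.
  toFun s := (fun i => (solution k s).trace (Function.surjInv G.vtx_surj (c i)),
    fun i => (solution k s).flux (c i))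
  map_add' s t := by
    simp only [solution_add, W22.trace_add, W22.flux_add]
    rfl
  map_smul' r s := by
    simp only [solution_smul, W22.trace_smul, W22.flux_smul]
    rfl

lemma hasContactData_iff {c : B ↪ G.V} {k : ℂ} {s : G.E → ℂ × ℂ} {ab : (B → ℂ) × (B → ℂ)} :
    (solution k s).HasContactData c ab.1 ab.2 ↔
      s ∈ G.freeData c k ∧ G.boundaryMap c k s = ab := by
  constructor
  · rintro ⟨h1, h2, h3, h4⟩
    exact ⟨⟨h1, h2⟩, Prod.ext (funext fun i => h3 i _ (Function.surjInv_eq _ _)) (funext h4)⟩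
  · rintro ⟨⟨h1, h2⟩, rfl⟩
    exact ⟨h1, h2, fun i p hp => h1 _ _ (hp.trans (Function.surjInv_eq _ _).symm), fun i => rfl⟩

lemma map_boundaryMap (c : B ↪ G.V) (k : ℂ) :
    (G.freeData c k).map (G.boundaryMap c k) = G.contactData c (k ^ 2) := by
  ext ⟨a, b⟩
  rw [mem_contactData_iff]
  exact exists_congr fun s => (hasContactData_iff (ab := (a, b))).symm

lemma standardData_eq (c : B ↪ G.V) (k : ℂ) :
    G.standardData k = G.freeData c k ⊓
      (LinearMap.ker (LinearMap.snd ℂ (B → ℂ) (B → ℂ))).comap (G.boundaryMap c k) := by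
  ext s
  constructor
  · rintro ⟨h1, h2⟩
    exact ⟨⟨h1, fun m _ => h2 m⟩, funext fun i => h2 (c i)⟩
  · rintro ⟨⟨h1, h2⟩, h3⟩
    refine ⟨h1, fun m => ?_⟩
    by_cases hm : m ∈ range c
    · obtain ⟨i, rfl⟩ := hm
      exact congrFun h3 i
    · exact h2 m hm

/-- The standard conditions add to the free ones only `b = 0`, a condition on the boundary data. -/
lemma finrank_standardData (c : B ↪ G.V) (k : ℂ) :
    Module.finrank ℂ (G.standardData k)
      = Module.finrank ℂ ↥(G.freeData c k ⊓ LinearMap.ker (G.boundaryMap c k))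
        + Module.finrank ℂ ↥(G.contactData c (k ^ 2) ⊓
          LinearMap.ker (LinearMap.snd ℂ (B → ℂ) (B → ℂ))) := by
  rw [standardData_eq c k, Submodule.finrank_inf_comap, map_boundaryMap]

/-! ### Gluing -/

/-- The compatibility condition of the initial data of a solution on `K` with given boundary data
at the contact vertices of a graph glued to `K`. The condition for the derivatives is in weak
form. -/
noncomputable def glueData (K : MetricGraph.{u}) [Fintype B] (P : Set (B × K.V)) (k : ℂ) :
    Submodule ℂ ((K.E → ℂ × ℂ) × (B → ℂ) × (B → ℂ)) where
  carrier := {q | (solution k q.1).ContinuousAtVertices ∧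
    (∀ i m, (i, m) ∈ P → (solution k q.1).HasValueAt m (q.2.1 i)) ∧
    -- The pairs `(φ, α)` are the restrictions of functions on the glued vertices, so the classes of
    -- identified vertices need not be described.
    ∀ (φ : K.V → ℂ) (α : B → ℂ), (∀ i m, (i, m) ∈ P → φ m = α i) →
      ∑ p, φ (K.vtx p) * (solution k q.1).normalDeriv p + ∑ i, α i * q.2.2 i = 0}
  zero_mem' := by
    simp only [mem_ofPred_eq, Prod.fst_zero, solution_zero]
    exact ⟨fun p q _ => by simp, fun i m _ p _ => by simp, fun φ α _ => by simp⟩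
  add_mem' := by
    intro s t hs ht
    simp only [mem_ofPred_eq, Prod.fst_add, solution_add] at hs ht ⊢
    refine ⟨hs.1.add ht.1, fun i m hm p hp => ?_, fun φ α h => ?_⟩
    · simp [hs.2.1 i m hm p hp, ht.2.1 i m hm p hp]
    · have := congrArg₂ (· + ·) (hs.2.2 φ α h) (ht.2.2 φ α h)
      simp only [add_zero] at this
      rw [← this]
      simp only [W22.normalDeriv_add, Prod.snd_add, Pi.add_apply, mul_add, Finset.sum_add_distrib]
      ring
  smul_mem' := by
    intro r s hs
    simp only [mem_ofPred_eq, Prod.smul_fst, solution_smul] at hs ⊢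
    refine ⟨hs.1.smul r, fun i m hm p hp => ?_, fun φ α h => ?_⟩
    · simp [hs.2.1 i m hm p hp]
    · have := congrArg (r * ·) (hs.2.2 φ α h)
      simp only [mul_zero] at this
      rw [← this]
      simp only [W22.normalDeriv_smul, Prod.smul_snd, Pi.smul_apply, smul_eq_mul, mul_add,
        Finset.mul_sum, mul_left_comm]

section Glue

variable {K R : MetricGraph.{u}} {c : B ↪ R.V} {P : Set (B × K.V)}

lemma glue_vtx_eq {i : B} {m : K.V} (h : (i, m) ∈ P) :
    Quot.mk (GlueRel K R c P) (Sum.inl m) = Quot.mk _ (Sum.inr (c i)) :=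
  Quot.sound (GlueRel.mk i m h)

lemma sum_glue (f : (glue K R c P).E × Bool → ℂ) : ∑ p, f p
    = ∑ p : K.E × Bool, f (Sum.inl p.1, p.2) + ∑ p : R.E × Bool, f (Sum.inr p.1, p.2) := by
  rw [Fintype.sum_prod_type, Fintype.sum_prod_type, Fintype.sum_prod_type]
  exact Fintype.sum_sum_type _

lemma standard_glue_iff [Fintype B] {k : ℂ} {s : K.E ⊕ R.E → ℂ × ℂ} :
    (solution (G := glue K R c P) k s).Standard ↔ s ∘ Sum.inr ∈ R.freeData c k ∧
      (s ∘ Sum.inl, R.boundaryMap c k (s ∘ Sum.inr)) ∈ K.glueData P k := by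
  classical
  set w := solution (G := glue K R c P) k s
  set wK := solution k (s ∘ Sum.inl)
  set wR := solution k (s ∘ Sum.inr)
  have hsum : ∀ ψ : (glue K R c P).V → ℂ, ∑ p, ψ ((glue K R c P).vtx p) * w.normalDeriv p
      = ∑ p, ψ (Quot.mk _ (Sum.inl (K.vtx p))) * wK.normalDeriv p
        + ∑ p, ψ (Quot.mk _ (Sum.inr (R.vtx p))) * wR.normalDeriv p := fun ψ => sum_glue _
  constructor
  · rintro ⟨h1, h2⟩
    have hweak : ∀ ψ : (glue K R c P).V → ℂ,
        ∑ p, ψ (Quot.mk _ (Sum.inl (K.vtx p))) * wK.normalDeriv p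
        + ∑ p, ψ (Quot.mk _ (Sum.inr (R.vtx p))) * wR.normalDeriv p = 0 := fun ψ => by
      have := Fintype.ofFinite (glue K R c P).V
      rw [← hsum, w.sum_mul_normalDeriv]
      exact Finset.sum_eq_zero fun m _ => by rw [h2, mul_zero]
    have hR0 : ∀ m, m ∉ range c → wR.flux m = 0 := fun m hm => by
      -- The indicator of a non-contact vertex descends to the quotient, since only contact vertices
      -- of `R` are identified with others.
      have := hweak (Quot.lift (Sum.elim 0 (Pi.single m 1)) (by
        rintro _ _ ⟨i, m', -⟩
        rw [Sum.elim_inl, Sum.elim_inr, Pi.single_eq_of_ne (fun h => hm ⟨i, h⟩)]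
        rfl))
      simpa [W22.flux, Pi.single_apply] using this
    refine ⟨⟨fun p q h => ?_, hR0⟩, fun p q h => ?_, fun i m hm p hp => ?_, fun φ α h => ?_⟩
    · exact h1 (Sum.inr p.1, p.2) (Sum.inr q.1, q.2)
        (congrArg (fun m => Quot.mk (GlueRel K R c P) (Sum.inr m)) h)
    · exact h1 (Sum.inl p.1, p.2) (Sum.inl q.1, q.2)
        (congrArg (fun m => Quot.mk (GlueRel K R c P) (Sum.inl m)) h)
    · refine h1 (Sum.inl p.1, p.2) (Sum.inr (Function.surjInv R.vtx_surj (c i)).1, _) ?_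
      change Quot.mk _ (Sum.inl (K.vtx p))
        = Quot.mk _ (Sum.inr (R.vtx (Function.surjInv R.vtx_surj (c i))))
      rw [hp, Function.surjInv_eq R.vtx_surj]
      exact glue_vtx_eq hm
    -- The values of the test function at non-contact vertices of `R` are arbitrary, as the fluxes
    -- vanish there.
    · have := hweak (Quot.lift (Sum.elim φ (Function.extend c α 0)) (by
        rintro _ _ ⟨i, m, hm⟩
        rw [Sum.elim_inl, Sum.elim_inr, c.injective.extend_apply, h i m hm]))
      simp only [Sum.elim_inl, Sum.elim_inr] at this
      rw [W22.sum_mul_normalDeriv_of_flux_eq_zero hR0] at this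
      simp only [c.injective.extend_apply] at this
      exact this
  · rintro ⟨⟨h1, h2⟩, h3, h4, h5⟩
    constructor
    -- Continuity after gluing means that the traces come from one function on the quotient; the
    -- matching of values in `glueData` makes it well defined.
    · let y : (glue K R c P).V → ℂ := Quot.lift (Sum.elim
        (fun m => wK.trace (Function.surjInv K.vtx_surj m))
        (fun m => wR.trace (Function.surjInv R.vtx_surj m))) (by
          rintro _ _ ⟨i, m, hm⟩
          exact h4 i m hm _ (Function.surjInv_eq _ _))
      have hy : ∀ p, w.trace p = y ((glue K R c P).vtx p) := by
        rintro ⟨e | e, b⟩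
        · exact h3 (e, b) _ (Function.surjInv_eq _ _).symm
        · exact h1 (e, b) _ (Function.surjInv_eq _ _).symm
      intro p q hpq
      rw [hy, hy, hpq]
    · intro ξ
      -- Testing with the indicator of the class `ξ` recovers the flux at `ξ`.
      have h6 := h5 (fun m => if Quot.mk _ (Sum.inl m) = ξ then 1 else 0)
        (fun i => if Quot.mk _ (Sum.inr (c i)) = ξ then 1 else 0)
        (fun i m hm => by simp only [glue_vtx_eq hm])
      have h7 := W22.sum_mul_normalDeriv_of_flux_eq_zero h2
        (fun m => if Quot.mk (GlueRel K R c P) (Sum.inr m) = ξ then 1 else 0)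
      have h8 := hsum (fun m => if m = ξ then 1 else 0)
      have h9 : ∑ p, (if (glue K R c P).vtx p = ξ then 1 else 0) * w.normalDeriv p = 0 :=
        h8.trans ((congrArg₂ (· + ·) rfl h7).trans h6)
      simp only [ite_mul, one_mul, zero_mul] at h9
      rw [W22.flux]
      convert h9

/-- After gluing, `R` enters the conditions only through its boundary data, up to the solutions for
which these vanish. -/
lemma finrank_standardData_glue [Fintype B] (k : ℂ) :
    Module.finrank ℂ ((glue K R c P).standardData k)
      = Module.finrank ℂ ↥(R.freeData c k ⊓ LinearMap.ker (R.boundaryMap c k))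
        + Module.finrank ℂ ↥(Submodule.prod ⊤ (R.contactData c (k ^ 2)) ⊓ K.glueData P k) := by
  rw [← map_boundaryMap, ← Submodule.finrank_prod_inf_comap_prodMap]
  let e : ((glue K R c P).E → ℂ × ℂ) ≃ₗ[ℂ] (K.E → ℂ × ℂ) × (R.E → ℂ × ℂ) :=
    LinearEquiv.sumArrowLequivProdArrow K.E R.E ℂ (ℂ × ℂ)
  have h : (glue K R c P).standardData k = Submodule.comap e.toLinearMap
      (Submodule.prod ⊤ (R.freeData c k) ⊓
        (K.glueData P k).comap (LinearMap.prodMap LinearMap.id (R.boundaryMap c k))) := by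
    ext s
    refine standard_glue_iff.trans ?_
    exact ⟨fun h => ⟨⟨trivial, h.1⟩, h.2⟩, fun h => ⟨h.1.2, h.2⟩⟩
  rw [h, Submodule.comap_equiv_eq_map_symm]
  exact LinearEquiv.finrank_map_eq e.symm _

end Glue

end MetricGraph

theorem mainTheorem2 {B : Type v} (K R₁ R₂ : MetricGraph.{u})
    (c₁ : B ↪ R₁.V) (c₂ : B ↪ R₂.V)
    (hM : MetricGraph.SteklovEquivalent R₁ c₁ R₂ c₂)
    (hiso : MetricGraph.Isospectral R₁ R₂)
    (P : Set (B × K.V)) :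
    MetricGraph.Isospectral (MetricGraph.glue K R₁ c₁ P) (MetricGraph.glue K R₂ c₂ P) := by
  have : Finite B := Finite.of_injective c₁ c₁.injective
  have := Fintype.ofFinite B
  intro μ
  obtain ⟨k, rfl⟩ := IsAlgClosed.exists_pow_nat_eq μ (n := 2) (by norm_num)
  have h1 := hiso (k ^ 2)
  have h2 := hM.contactData_eq (k ^ 2)
  rw [MetricGraph.rank_eigenspace, MetricGraph.rank_eigenspace, Nat.cast_inj] at h1 ⊢
  -- Equal boundary data cancel from the multiplicities of `R₁` and `R₂`, leaving equal dimensions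
  -- of the invisible parts.
  rw [MetricGraph.finrank_standardData c₁, MetricGraph.finrank_standardData c₂, h2,
    Nat.add_right_cancel_iff] at h1
  rw [MetricGraph.finrank_standardData_glue, MetricGraph.finrank_standardData_glue, h1, h2]
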